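/- Let $\mathfrak g$ be a finite-dimensional complex semisimple Lie algebra with Cartan subalgebra $\mathfrak h$, let $\Pi$ be the set of roots of $(\mathfrak g,\mathfrak h)$, let $\Pi^+\subset\Pi$ be the set of positive roots with respect to a choice of simple roots, and let $l=|\Pi^+|$. Let $U$ be a compact connected Lie group whose Lie algebra $\mathfrak u$ is a real form of $\mathfrak g$ (that is, $\mathfrak u\otimes_{\mathbb R}\mathbb C\cong\mathfrak g$), let $T\subset U$ be a closed connected subgroup whose Lie algebra $\mathfrak t$ satisfies $\mathfrak t\otimes_{\mathbb R}\mathbb C=\mathfrak h$ (so $T$ is a maximal torus), and let $\mathbb F=U/T$ be the maximal flag manifold, with the smooth structure for which $U\to U/T$ is a submersion. A complex Dirac structure on $\mathbb F$ is a smooth complex subbundle $L\subset(T\mathbb F\oplus T^*\mathbb F)\otimes\mathbb C$ that is maximal isotropic for the complex bilinear extension of $\langle X+\xi,Y+\eta\rangle=\frac12(\xi(Y)+\eta(X))$ and whose smooth sections are closed under the Courant bracket $$[X+\xi,Y+\eta]=[X,Y]+\mathcal L_X\eta-\mathcal L_Y\xi-\tfrac12\,d(i_X\eta-i_Y\xi).$$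 It is $U$-invariant if for every $u\in U$ and $x\in\mathbb F$ the map $(d\phi_u\oplus(d\phi_u^{-1})^*)\otimes\mathbb C$ induced by $\phi_u:\mathbb F\to\mathbb F$, $\phi_u(y)=u\cdot y$, maps $L_x$ onto $L_{u\cdot x}$. The real index of $L$ at $x$ is $\dim_{\mathbb C}(L_x\cap\overline{L_x})$. Theorem. Let $L$ be a $U$-invariant complex Dirac structure on $\mathbb F$. Then the real index of $L$ is constant on $\mathbb F$ and equal to $2k$ for some integer $k$ with $0\le k\le l$. -/

import Mathlib

open scoped Manifold ContDiff TensorProduct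

noncomputable section

namespace DiracFlag

section LinearAlgebra

variable (V : Type*) [AddCommGroup V] [Module ℝ V] [TopologicalSpace V] [IsTopologicalAddGroup V]
  [ContinuousSMul ℝ V]

/-- The generalized space `V ⊕ V*` of a real vector space `V`. -/
abbrev Gen : Type _ := V × (V →L[ℝ] ℝ)

/-- The complexification `(V ⊕ V*) ⊗ ℂ`. -/
abbrev CGen : Type _ := ℂ ⊗[ℝ] Gen V

/-- The natural symmetric pairing `⟨X + ξ, Y + η⟩ = (ξ(Y) + η(X)) / 2` on `V ⊕ V*`. -/
def pairing : LinearMap.BilinForm ℝ (Gen V) :=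
  LinearMap.mk₂ ℝ (fun a b => (1 / 2 : ℝ) * (a.2 b.1 + b.2 a.1))
    (by intro a b c; simp; ring) (by intro r a b; simp; ring)
    (by intro a b c; simp; ring) (by intro r a b; simp; ring)

/-- The complex bilinear extension of the natural pairing to `(V ⊕ V*) ⊗ ℂ`. -/
def pairingC : LinearMap.BilinForm ℂ (CGen V) := (pairing V).baseChange ℂ

/-- Complex conjugation `z ⊗ v ↦ conj z ⊗ v` on `(V ⊕ V*) ⊗ ℂ`. -/
def conj : CGen V →ₛₗ[starRingEnd ℂ] CGen V where
  toFun := LinearMap.rTensor (Gen V) Complex.conjAe.toLinearMap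
  map_add' := map_add _
  map_smul' c v := by
    induction v using TensorProduct.induction_on with
    | zero => simp
    | tmul z v => simp [TensorProduct.smul_tmul']
    | add a b ha hb => rw [smul_add, map_add, ha, hb, map_add, smul_add]

variable {V}

/-- A complex subspace of `(V ⊕ V*) ⊗ ℂ` on which the natural pairing vanishes. -/
def IsIsotropic (L : Submodule ℂ (CGen V)) : Prop :=
  ∀ a ∈ L, ∀ b ∈ L, pairingC V a b = 0

/-- An isotropic subspace that is not contained in a larger one. -/
def IsMaximalIsotropic (L : Submodule ℂ (CGen V)) : Prop := Maximal IsIsotropic L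

/-- The real index `dim_ℂ (L ∩ conj L)` of a complex subspace `L` of `(V ⊕ V*) ⊗ ℂ`. -/
def realIndex (L : Submodule ℂ (CGen V)) : ℕ :=
  Module.finrank ℂ (L ⊓ L.map (conj V) : Submodule ℂ (CGen V))

variable {W : Type*} [AddCommGroup W] [Module ℝ W] [TopologicalSpace W] [IsTopologicalAddGroup W]
  [ContinuousSMul ℝ W]

/-- The map `X + ξ ↦ A X + ξ ∘ A⁻¹` from `V ⊕ V*` to `W ⊕ W*` induced by an invertible
linear map `A : V → W`. -/
def pushGen (A : V →L[ℝ] W) : Gen V →ₗ[ℝ] Gen W where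
  toFun a := (A a.1, a.2.comp A.inverse)
  map_add' a b := by ext <;> simp
  map_smul' r a := by ext <;> simp

/-- The complex linear extension of `X + ξ ↦ A X + ξ ∘ A⁻¹`. -/
def pushGenC (A : V →L[ℝ] W) : CGen V →ₗ[ℂ] CGen W := (pushGen A).baseChange ℂ

end LinearAlgebra

section Manifold

variable {E : Type*} [NormedAddCommGroup E] [NormedSpace ℝ E]
  {M : Type*} [TopologicalSpace M] [ChartedSpace E M]

/-- A (not necessarily smooth) vector field on `M`. -/
abbrev VField (E M : Type*) [NormedAddCommGroup E] [NormedSpace ℝ E] [TopologicalSpace M]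
    [ChartedSpace E M] : Type _ :=
  ∀ x : M, TangentSpace 𝓘(ℝ, E) x

/-- A (not necessarily smooth) `1`-form on `M`. -/
abbrev Form (E M : Type*) [NormedAddCommGroup E] [NormedSpace ℝ E] [TopologicalSpace M]
    [ChartedSpace E M] : Type _ :=
  ∀ x : M, TangentSpace 𝓘(ℝ, E) x →L[ℝ] ℝ

/-- A (not necessarily smooth) section of `TM ⊕ T*M`. -/
structure GSection (E M : Type*) [NormedAddCommGroup E] [NormedSpace ℝ E] [TopologicalSpace M]
    [ChartedSpace E M] where
  vec : VField E M
  form : Form E M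

/-- The value at `x` of a section of `TM ⊕ T*M`. -/
def GSection.val (a : GSection E M) (x : M) : Gen (TangentSpace 𝓘(ℝ, E) x) := (a.vec x, a.form x)

/-- Smoothness of a section of `TM ⊕ T*M` on a set: both components are smooth sections, of the
tangent bundle and of the bundle of continuous linear maps from the tangent bundle to the trivial
line bundle. -/
def GSection.SmoothOn [IsManifold 𝓘(ℝ, E) ∞ M] (a : GSection E M) (W : Set M) : Prop :=
  ContMDiffOn 𝓘(ℝ, E) (𝓘(ℝ, E).prod 𝓘(ℝ, E)) ∞
    (fun x => (⟨x, a.vec x⟩ : TangentBundle 𝓘(ℝ, E) M)) W ∧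
  ContMDiffOn 𝓘(ℝ, E) (𝓘(ℝ, E).prod 𝓘(ℝ, E →L[ℝ] ℝ)) ∞
    (fun x => (Bundle.TotalSpace.mk' (E →L[ℝ] ℝ) x (a.form x) :
      Bundle.TotalSpace (E →L[ℝ] ℝ)
        (fun x : M => TangentSpace 𝓘(ℝ, E) x →L[ℝ] Bundle.Trivial M ℝ x))) W

/-- The Lie derivative of a `1`-form on a normed space along a vector field:
`(L_X η)_y (v) = (D_{X(y)} η)(v) + η_y (D_v X)`. -/
def flatLieDerivForm (X : E → E) (η : E → E →L[ℝ] ℝ) (y : E) : E →L[ℝ] ℝ :=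
  fderiv ℝ η y (X y) + (η y).comp (fderiv ℝ X y)

/-- The Lie derivative `L_X η` at `x` of a `1`-form along a vector field, computed in the preferred
chart at `x`. -/
def lieDerivForm (X : VField E M) (η : Form E M) : Form E M := fun x =>
  (flatLieDerivForm
      (VectorField.mpullback 𝓘(ℝ, E) 𝓘(ℝ, E) (extChartAt 𝓘(ℝ, E) x).symm X)
      (fun y => (η ((extChartAt 𝓘(ℝ, E) x).symm y)).comp
        (mfderiv 𝓘(ℝ, E) 𝓘(ℝ, E) (extChartAt 𝓘(ℝ, E) x).symm y))
      (extChartAt 𝓘(ℝ, E) x x)).comp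
    (mfderiv 𝓘(ℝ, E) 𝓘(ℝ, E) (extChartAt 𝓘(ℝ, E) x) x)

/-- The differential of a function on `M`. -/
def diffForm (f : M → ℝ) : Form E M := fun x => mfderiv 𝓘(ℝ, E) 𝓘(ℝ, ℝ) f x

/-- The Courant bracket
`[X + ξ, Y + η] = [X, Y] + L_X η - L_Y ξ - d(i_X η - i_Y ξ) / 2` on sections of `TM ⊕ T*M`. -/
def courant (a b : GSection E M) : GSection E M where
  vec := VectorField.mlieBracket 𝓘(ℝ, E) a.vec b.vec
  form x := lieDerivForm a.vec b.form x - lieDerivForm b.vec a.form x -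
    (1 / 2 : ℝ) • diffForm (fun y => b.form y (a.vec y) - a.form y (b.vec y)) x

/-- A section `re + i im` of `(TM ⊕ T*M) ⊗ ℂ`, with `re`, `im` sections of `TM ⊕ T*M`. -/
structure CSection (E M : Type*) [NormedAddCommGroup E] [NormedSpace ℝ E] [TopologicalSpace M]
    [ChartedSpace E M] where
  re : GSection E M
  im : GSection E M

/-- The value `1 ⊗ re x + i ⊗ im x` at `x` of a section of `(TM ⊕ T*M) ⊗ ℂ`. -/
def CSection.val (s : CSection E M) (x : M) : CGen (TangentSpace 𝓘(ℝ, E) x) :=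
  (1 : ℂ) ⊗ₜ[ℝ] s.re.val x + Complex.I ⊗ₜ[ℝ] s.im.val x

/-- Smoothness on a set of a section of `(TM ⊕ T*M) ⊗ ℂ`. -/
def CSection.SmoothOn [IsManifold 𝓘(ℝ, E) ∞ M] (s : CSection E M) (W : Set M) : Prop :=
  s.re.SmoothOn W ∧ s.im.SmoothOn W

/-- The value at `x` of the complex bilinear extension
`[a + ib, c + id] = ([a, c] - [b, d]) + i ([a, d] + [b, c])` of the Courant bracket. -/
def courantC (s t : CSection E M) (x : M) : CGen (TangentSpace 𝓘(ℝ, E) x) :=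
  (1 : ℂ) ⊗ₜ[ℝ] ((courant s.re t.re).val x - (courant s.im t.im).val x) +
    Complex.I ⊗ₜ[ℝ] ((courant s.re t.im).val x + (courant s.im t.re).val x)

variable (E M) in
/-- A complex Dirac structure on `M`: a smooth complex subbundle `L` of `(TM ⊕ T*M) ⊗ ℂ` that is
maximal isotropic and whose (local) smooth sections are closed under the Courant bracket. -/
structure ComplexDirac [IsManifold 𝓘(ℝ, E) ∞ M] where
  fiber : ∀ x : M, Submodule ℂ (CGen (TangentSpace 𝓘(ℝ, E) x))
  smooth_frame : ∀ x₀ : M, ∃ (r : ℕ) (W : Set M) (s : Fin r → CSection E M),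
    IsOpen W ∧ x₀ ∈ W ∧ (∀ i, (s i).SmoothOn W) ∧
    ∀ x ∈ W, LinearIndependent ℂ (fun i => (s i).val x) ∧
      Submodule.span ℂ (Set.range fun i => (s i).val x) = fiber x
  isMaximalIsotropic : ∀ x, IsMaximalIsotropic (fiber x)
  involutive : ∀ (W : Set M) (s t : CSection E M), IsOpen W → s.SmoothOn W → t.SmoothOn W →
    (∀ x ∈ W, s.val x ∈ fiber x) → (∀ x ∈ W, t.val x ∈ fiber x) →
    ∀ x ∈ W, courantC s t x ∈ fiber x

/-- Invariance of a complex Dirac structure under a group acting on `M`: for every `g`, the natural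
lift `(dφ_g ⊕ (dφ_g⁻¹)*) ⊗ ℂ` of the diffeomorphism `φ_g = (g • ·)` maps `L_x` onto `L_{g • x}`. -/
def ComplexDirac.IsInvariant [IsManifold 𝓘(ℝ, E) ∞ M] (L : ComplexDirac E M)
    (U : Type*) [Group U] [MulAction U M] : Prop :=
  ∀ (g : U) (x : M),
    (L.fiber x).map (pushGenC (mfderiv 𝓘(ℝ, E) 𝓘(ℝ, E) (fun y : M => g • y) x)) =
      L.fiber (g • x)

end Manifold

section LieGroup

variable {E : Type*} [NormedAddCommGroup E] [NormedSpace ℝ E]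
  {U : Type*} [TopologicalSpace U] [ChartedSpace E U] [Group U]

/-- A smooth Lie group is regular enough for Mathlib's Lie algebra structure on its tangent space
at the identity. -/
instance lieGroupMinSmoothness [LieGroup 𝓘(ℝ, E) ∞ U] :
    LieGroup 𝓘(ℝ, E) (minSmoothness ℝ 3) U :=
  LieGroup.of_le (n := ∞) (by rw [minSmoothness_of_isRCLikeNormedField]; exact ENat.LEInfty.out)

variable (E) in
/-- The Lie algebra of a closed subgroup `T` of a Lie group `U`, as a subset of the Lie algebra
of `U`: the initial velocities of the smooth one-parameter subgroups of `U` with values in `T`. -/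
def subgroupLieAlgebra (T : Subgroup U) : Set (GroupLieAlgebra 𝓘(ℝ, E) U) :=
  {X | ∃ γ : ℝ → U, ContMDiff 𝓘(ℝ, ℝ) 𝓘(ℝ, E) ∞ γ ∧ (∀ s t, γ (s + t) = γ s * γ t) ∧
    (∀ t, γ t ∈ T) ∧
    tangentMap 𝓘(ℝ, ℝ) 𝓘(ℝ, E) γ ⟨0, (1 : ℝ)⟩ = (⟨1, X⟩ : TangentBundle 𝓘(ℝ, E) U)}

end LieGroup

section Roots

variable {𝔤 : Type*} [LieRing 𝔤] [LieAlgebra ℂ 𝔤] [FiniteDimensional ℂ 𝔤]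
  [LieAlgebra.IsSemisimple ℂ 𝔤] {𝔥 : LieSubalgebra ℂ 𝔤} [𝔥.IsCartanSubalgebra]

/-- The number of roots of `(𝔤, 𝔥)` that are positive relative to a base. -/
def numPosRoots (b : (LieAlgebra.IsKilling.rootSystem 𝔥).Base) : ℕ :=
  Nat.card {α : 𝔥.root // b.IsPos α}

end Roots

end DiracFlag

end

/-! The intersection `L ∩ conj L` is the complexification of the space `K` of real points of `L`, so
the real index is `dim_ℝ K`. By invariance and transitivity it is the same everywhere, and it is
enough to treat the base point `o`, whose tangent space `V` is the quotient of the Lie algebra of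
`U` by the isotropy directions.

Bound: `K` is isotropic for a nondegenerate pairing on `V ⊕ V*`, so `dim K ≤ dim V`
(`finrank_realPart_le`). The complexified projection onto `V` kills the Cartan subalgebra, so `dim
V` is at most the number of roots (`finrank_le_card_root`), which is at most `2l` (`card_root_le`).

Parity: `K` is stable under the isotropy action of `T`, hence under `v + ξ ↦ D v - ξ ∘ D`, where `D`
is induced on `V` by `ad X` for `X` in the span of the Lie algebra of `T` (`isotropyAlgebra_action`,
`stable_of_mem_span`). Compactness bounds `Ad`, which forces the roots to be imaginary there
(`re_root_eq_zero`). For `X` off the zero sets of all roots, `P = ∏ (x² + (Im α(X))²)` has no real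
root and `P(ad X)` maps into the Cartan subalgebra, so `P(D) = 0` (`exists_regular_polynomial`). The
operator on `K` then has no real eigenvalue, and `dim K` is even (`even_finrank_of_stable`). -/

noncomputable section

namespace DiracFlag

/-! ### The adjoint action, and multiplication in the chart at the identity -/

section Adjoint

variable {E : Type*} [NormedAddCommGroup E] [NormedSpace ℝ E]
  {U : Type*} [TopologicalSpace U] [ChartedSpace E U] [Group U] 

variable (E) in
/-- The adjoint action of a Lie group on its Lie algebra. -/
def Ad (g : U) : E →L[ℝ] E := mfderiv 𝓘(ℝ, E) 𝓘(ℝ, E) (fun x : U => g * x * g⁻¹) 1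

variable [LieGroup 𝓘(ℝ, E) ∞ U]

theorem hasMFDerivAt_congr_deriv {F M N : Type*} [NormedAddCommGroup F] [NormedSpace ℝ F]
    [TopologicalSpace M] [ChartedSpace E M] [TopologicalSpace N] [ChartedSpace F N]
    {f : M → N} {x : M} {A B : E →L[ℝ] F} (h : HasMFDerivAt 𝓘(ℝ, E) 𝓘(ℝ, F) f x A) (hAB : A = B) :
    HasMFDerivAt 𝓘(ℝ, E) 𝓘(ℝ, F) f x B := hAB ▸ h

theorem contMDiff_conj (g : U) :
    ContMDiff 𝓘(ℝ, E) 𝓘(ℝ, E) ∞ (fun x : U => g * x * g⁻¹) :=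
  (contMDiff_const.mul contMDiff_id).mul contMDiff_const

theorem hasMFDerivAt_Ad (g : U) :
    HasMFDerivAt 𝓘(ℝ, E) 𝓘(ℝ, E) (fun x : U => g * x * g⁻¹) 1 (Ad E g) :=
  ((contMDiff_conj g).mdifferentiable (by simp) 1).hasMFDerivAt

theorem Ad_mul (g h : U) : Ad E (g * h) = (Ad E g).comp (Ad E h) := by
  have h1 : HasMFDerivAt 𝓘(ℝ, E) 𝓘(ℝ, E) (fun x : U => g * x * g⁻¹) (h * 1 * h⁻¹) (Ad E g) := by
    rw [mul_one, mul_inv_cancel]; exact hasMFDerivAt_Ad g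
  have h2 := HasMFDerivAt.comp (1 : U) h1 (hasMFDerivAt_Ad h)
  have h3 := hasMFDerivAt_Ad (E := E) (g * h)
  have : (fun x : U => g * x * g⁻¹) ∘ (fun x : U => h * x * h⁻¹) =
    (fun x : U => g * h * x * (g * h)⁻¹) := by
    ext x; simp [mul_assoc]
  rw [this] at h2
  exact hasMFDerivAt_unique h3 h2

theorem Ad_one : Ad E (1 : U) = ContinuousLinearMap.id ℝ E := by
  have h3 := hasMFDerivAt_Ad (E := E) (1 : U)
  have : (fun x : U => 1 * x * 1⁻¹) = id := by ext x; simp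
  rw [this] at h3
  exact hasMFDerivAt_unique h3 (hasMFDerivAt_id _)

/-- Joint smoothness of `(g, x) ↦ g x g⁻¹` makes its derivative in `x` at `1` smooth in `g` when
read in tangent coordinates. The base points involved all equal `1`, where these coordinates are the
identity. -/
theorem contMDiff_Ad : ContMDiff 𝓘(ℝ, E) 𝓘(ℝ, E →L[ℝ] E) ∞ (Ad E : U → E →L[ℝ] E) := by
  intro g
  have : IsManifold 𝓘(ℝ, E) 1 U := IsManifold.of_le (n := ∞) (by simp)
  have := ContMDiffAt.mfderiv (I := 𝓘(ℝ, E)) (I' := 𝓘(ℝ, E)) (J := 𝓘(ℝ, E)) (n := ∞) (m := ∞)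
    (x₀ := g) (fun g x : U => g * x * g⁻¹) (fun _ => 1) ?_ contMDiffAt_const le_rfl
  · refine this.congr_of_eventuallyEq (Filter.Eventually.of_forall fun h => ?_)
    simp only [inTangentCoordinates, ContinuousLinearMap.inCoordinates]
    -- The base points occur as `g * 1 * g⁻¹`, equal to `1` only propositionally; making them
    -- variables lets the equalities be substituted.
    have key : ∀ z₀ z : U, z₀ = 1 → z = 1 → ∀ A : E →L[ℝ] E,
        A = ((trivializationAt E (TangentSpace 𝓘(ℝ, E)) z₀).continuousLinearMapAt ℝ z).comp
        (A.comp ((trivializationAt E (TangentSpace 𝓘(ℝ, E)) (1 : U)).symmL ℝ 1)) := by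
      rintro _ _ rfl rfl A
      rw [TangentBundle.continuousLinearMapAt_trivializationAt (mem_chart_source E (1 : U)),
        TangentBundle.symmL_trivializationAt (mem_chart_source E (1 : U)),
        mfderiv_extChartAt_self]
      erw [mfderivWithin_range_extChartAt_symm]
      rfl
    exact key _ _ (by simp) (by simp) _
  · exact ((contMDiff_fst.mul contMDiff_snd).mul contMDiff_fst.inv).contMDiffAt


variable (E U) in
/-- The multiplication of a Lie group read in the preferred chart at the identity. -/
def mulInChart (p : E × E) : E :=
  extChartAt 𝓘(ℝ, E) (1 : U)
    ((extChartAt 𝓘(ℝ, E) (1 : U)).symm p.1 * (extChartAt 𝓘(ℝ, E) (1 : U)).symm p.2)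

variable (E U) in
/-- The coordinates of the identity in its preferred chart. -/
abbrev unitCoord : E := extChartAt 𝓘(ℝ, E) (1 : U) 1

theorem contDiffAt_mulInChart :
    ContDiffAt ℝ ∞ (mulInChart E U) (unitCoord E U, unitCoord E U) := by
  rw [← contMDiffAt_iff_contDiffAt]
  have h1 : ContMDiffAt 𝓘(ℝ, E) 𝓘(ℝ, E) ∞ (extChartAt 𝓘(ℝ, E) (1 : U)).symm (unitCoord E U) :=
    (contMDiffOn_extChartAt_symm (1 : U)).contMDiffAt (extChartAt_target_mem_nhds (1 : U))
  have h2 : ContMDiffAt 𝓘(ℝ, E) 𝓘(ℝ, E) ∞ (extChartAt 𝓘(ℝ, E) (1 : U))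
      ((extChartAt 𝓘(ℝ, E) (1 : U)).symm (unitCoord E U) *
        (extChartAt 𝓘(ℝ, E) (1 : U)).symm (unitCoord E U)) := by
    simp only [extChartAt_to_inv, mul_one]
    exact contMDiffAt_extChartAt
  exact h2.comp (unitCoord E U, unitCoord E U)
    ((h1.comp (unitCoord E U, unitCoord E U) contDiffAt_fst.contMDiffAt).mul
      (h1.comp (unitCoord E U, unitCoord E U) contDiffAt_snd.contMDiffAt))

/-- The tangent space at a point is identified with `E` through the preferred chart there, so this
chart has identity derivative at its own centre. -/
theorem hasMFDerivAt_chart_symm_unit :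
    HasMFDerivAt 𝓘(ℝ, E) 𝓘(ℝ, E) (extChartAt 𝓘(ℝ, E) (1 : U)).symm (unitCoord E U)
      (ContinuousLinearMap.id ℝ E) := by
  have : IsManifold 𝓘(ℝ, E) 1 U := IsManifold.of_le (n := ∞) (by simp)
  have h1 : ContMDiffAt 𝓘(ℝ, E) 𝓘(ℝ, E) ∞ (extChartAt 𝓘(ℝ, E) (1 : U)).symm (unitCoord E U) :=
    (contMDiffOn_extChartAt_symm (1 : U)).contMDiffAt (extChartAt_target_mem_nhds (1 : U))
  have h := (h1.mdifferentiableAt (by simp)).hasMFDerivAt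
  have h2 := mfderivWithin_range_extChartAt_symm (I := 𝓘(ℝ, E)) (x := (1 : U))
  rw [modelWithCornersSelf_coe, Set.range_id, mfderivWithin_univ] at h2
  rw [h2] at h
  exact h

theorem hasMFDerivAt_chart {g : U} (hg : g ∈ (chartAt E (1 : U)).source) :
    HasMFDerivAt 𝓘(ℝ, E) 𝓘(ℝ, E) (extChartAt 𝓘(ℝ, E) (1 : U)) g
      (mfderiv 𝓘(ℝ, E) 𝓘(ℝ, E) (extChartAt 𝓘(ℝ, E) (1 : U)) g) := by
  have : IsManifold 𝓘(ℝ, E) 1 U := IsManifold.of_le (n := ∞) (by simp)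
  exact (mdifferentiableAt_extChartAt hg).hasMFDerivAt

/-- In the chart at the identity, the derivative of left translation by `g` at the identity is the
partial derivative of the multiplication in the second variable. -/
theorem eventually_fderiv_mulInChart_snd :
    ∀ᶠ y in nhds (unitCoord E U), ∀ A B : E →L[ℝ] E,
      HasMFDerivAt 𝓘(ℝ, E) 𝓘(ℝ, E)
        (fun x : U => (extChartAt 𝓘(ℝ, E) (1 : U)).symm y * x) 1 A →
      HasMFDerivAt 𝓘(ℝ, E) 𝓘(ℝ, E) (extChartAt 𝓘(ℝ, E) (1 : U))
        ((extChartAt 𝓘(ℝ, E) (1 : U)).symm y) B →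
      ∀ v, fderiv ℝ (mulInChart E U) (y, unitCoord E U) (0, v) = B (A v) := by
  have h1 : ∀ᶠ y in nhds (unitCoord E U),
      DifferentiableAt ℝ (mulInChart E U) (y, unitCoord E U) := by
    have h := ((contDiffAt_mulInChart (E := E) (U := U)).of_le (m := 1) (by simp)).eventually (by simp)
    have hc : Filter.Tendsto (fun y : E => (y, unitCoord E U)) (nhds (unitCoord E U))
      (nhds (unitCoord E U, unitCoord E U)) := (Continuous.prodMk_left _).tendsto _
    filter_upwards [hc.eventually h] with y hy using hy.differentiableAt (by simp)
  filter_upwards [h1] with y hy A B hA hB v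
  have e1 : HasFDerivAt (fun z => mulInChart E U (y, z))
      ((fderiv ℝ (mulInChart E U) (y, unitCoord E U)).comp (ContinuousLinearMap.inr ℝ E E))
      (unitCoord E U) :=
    HasFDerivAt.comp (unitCoord E U) hy.hasFDerivAt (hasFDerivAt_prodMk_right y _)
  have hA' : HasMFDerivAt 𝓘(ℝ, E) 𝓘(ℝ, E)
        (fun x : U => (extChartAt 𝓘(ℝ, E) (1 : U)).symm y * x)
        ((extChartAt 𝓘(ℝ, E) (1 : U)).symm (unitCoord E U)) A := by
    rw [extChartAt_to_inv]; exact hA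
  have hB' : HasMFDerivAt 𝓘(ℝ, E) 𝓘(ℝ, E) (extChartAt 𝓘(ℝ, E) (1 : U))
        ((extChartAt 𝓘(ℝ, E) (1 : U)).symm y *
          (extChartAt 𝓘(ℝ, E) (1 : U)).symm (unitCoord E U)) B := by
    rw [extChartAt_to_inv, mul_one]; exact hB
  have e2 := HasMFDerivAt.comp (unitCoord E U) hB'
    (HasMFDerivAt.comp (unitCoord E U) hA' hasMFDerivAt_chart_symm_unit)
  have e3 := e1.unique (hasMFDerivAt_iff_hasFDerivAt.1 e2)
  have e4 := DFunLike.congr_fun e3 v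
  exact e4

/-- In the chart at the identity, the derivative of right translation by `g` at the identity is the
partial derivative of the multiplication in the first variable. -/
theorem eventually_fderiv_mulInChart_fst :
    ∀ᶠ y in nhds (unitCoord E U), ∀ A B : E →L[ℝ] E,
      HasMFDerivAt 𝓘(ℝ, E) 𝓘(ℝ, E)
        (fun x : U => x * (extChartAt 𝓘(ℝ, E) (1 : U)).symm y) 1 A →
      HasMFDerivAt 𝓘(ℝ, E) 𝓘(ℝ, E) (extChartAt 𝓘(ℝ, E) (1 : U))
        ((extChartAt 𝓘(ℝ, E) (1 : U)).symm y) B →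
      ∀ v, fderiv ℝ (mulInChart E U) (unitCoord E U, y) (v, 0) = B (A v) := by
  have h1 : ∀ᶠ y in nhds (unitCoord E U),
      DifferentiableAt ℝ (mulInChart E U) (unitCoord E U, y) := by
    have h := ((contDiffAt_mulInChart (E := E) (U := U)).of_le (m := 1) (by simp)).eventually (by simp)
    have hc : Filter.Tendsto (fun y : E => (unitCoord E U, y)) (nhds (unitCoord E U))
      (nhds (unitCoord E U, unitCoord E U)) := (Continuous.prodMk_right _).tendsto _
    filter_upwards [hc.eventually h] with y hy using hy.differentiableAt (by simp)
  filter_upwards [h1] with y hy A B hA hB v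
  have e1 : HasFDerivAt (fun z => mulInChart E U (z, y))
      ((fderiv ℝ (mulInChart E U) (unitCoord E U, y)).comp (ContinuousLinearMap.inl ℝ E E))
      (unitCoord E U) :=
    HasFDerivAt.comp (f := fun z => (z, y)) (unitCoord E U) hy.hasFDerivAt
      (hasFDerivAt_prodMk_left (unitCoord E U) y)
  have hA' : HasMFDerivAt 𝓘(ℝ, E) 𝓘(ℝ, E)
        (fun x : U => x * (extChartAt 𝓘(ℝ, E) (1 : U)).symm y)
        ((extChartAt 𝓘(ℝ, E) (1 : U)).symm (unitCoord E U)) A := by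
    rw [extChartAt_to_inv]; exact hA
  have hB' : HasMFDerivAt 𝓘(ℝ, E) 𝓘(ℝ, E) (extChartAt 𝓘(ℝ, E) (1 : U))
        ((extChartAt 𝓘(ℝ, E) (1 : U)).symm (unitCoord E U) *
          (extChartAt 𝓘(ℝ, E) (1 : U)).symm y) B := by
    rw [extChartAt_to_inv, one_mul]; exact hB
  have e2 := HasMFDerivAt.comp (unitCoord E U) hB'
    (HasMFDerivAt.comp (unitCoord E U) hA' hasMFDerivAt_chart_symm_unit)
  have e3 := e1.unique (hasMFDerivAt_iff_hasFDerivAt.1 e2)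
  have e4 := DFunLike.congr_fun e3 v
  exact e4

end Adjoint

/-! ### The derivative of `Ad` at the identity is the Lie bracket -/

section AdjointDerivative

variable {E : Type*} [NormedAddCommGroup E] [NormedSpace ℝ E]
  {U : Type*} [TopologicalSpace U] [ChartedSpace E U] [Group U] [LieGroup 𝓘(ℝ, E) ∞ U]

theorem hasMFDerivAt_mul_left (g x : U) :
    HasMFDerivAt 𝓘(ℝ, E) 𝓘(ℝ, E) (fun y : U => g * y) x
      (mfderiv 𝓘(ℝ, E) 𝓘(ℝ, E) (fun y : U => g * y) x) :=
  ((contMDiff_mul_left (I := 𝓘(ℝ, E)) (n := ∞)).mdifferentiable (by simp) x).hasMFDerivAt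

theorem hasMFDerivAt_mul_right (g x : U) :
    HasMFDerivAt 𝓘(ℝ, E) 𝓘(ℝ, E) (fun y : U => y * g) x
      (mfderiv 𝓘(ℝ, E) 𝓘(ℝ, E) (fun y : U => y * g) x) :=
  ((contMDiff_mul_right (I := 𝓘(ℝ, E)) (n := ∞)).mdifferentiable (by simp) x).hasMFDerivAt

/-- Conjugation followed by right translation is left translation, read in the chart. -/
theorem eventually_fderiv_mulInChart_Ad :
    ∀ᶠ y in nhds (unitCoord E U), ∀ v : E,
      fderiv ℝ (mulInChart E U) (unitCoord E U, y) (Ad E ((extChartAt 𝓘(ℝ, E) (1 : U)).symm y) v, 0)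
        = fderiv ℝ (mulInChart E U) (y, unitCoord E U) (0, v) := by
  filter_upwards [eventually_fderiv_mulInChart_fst (E := E) (U := U),
    eventually_fderiv_mulInChart_snd (E := E) (U := U),
    extChartAt_target_mem_nhds (I := 𝓘(ℝ, E)) (1 : U)] with y h1 h2 hy v
  set g := (extChartAt 𝓘(ℝ, E) (1 : U)).symm y with hg
  have hgs : g ∈ (chartAt E (1 : U)).source := by
    rw [← extChartAt_source 𝓘(ℝ, E)]; exact (extChartAt 𝓘(ℝ, E) (1 : U)).map_target hy
  have hB := hasMFDerivAt_chart hgs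
  have hR := hasMFDerivAt_mul_right (E := E) g 1
  have hL := hasMFDerivAt_mul_left (E := E) g 1
  refine (h1 _ _ hR hB _).trans (Eq.trans ?_ (h2 _ _ hL hB v).symm)
  have hR' : HasMFDerivAt 𝓘(ℝ, E) 𝓘(ℝ, E) (fun y : U => y * g) (g * 1 * g⁻¹)
      (mfderiv 𝓘(ℝ, E) 𝓘(ℝ, E) (fun y : U => y * g) 1) := by
    rw [mul_one, mul_inv_cancel]; exact hR
  have e := HasMFDerivAt.comp (1 : U) hR' (hasMFDerivAt_Ad g)
  have e' : (fun y : U => y * g) ∘ (fun x : U => g * x * g⁻¹) = fun y : U => g * y := by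
    ext; simp
  rw [e'] at e
  have := hasMFDerivAt_unique e hL
  exact congrArg (mfderiv 𝓘(ℝ, E) 𝓘(ℝ, E) (extChartAt 𝓘(ℝ, E) (1 : U)) g)
    (DFunLike.congr_fun this v)

theorem fderiv_mulInChart_unit_fst (v : E) :
    fderiv ℝ (mulInChart E U) (unitCoord E U, unitCoord E U) (v, 0) = v := by
  have h := (eventually_fderiv_mulInChart_fst (E := E) (U := U)).self_of_nhds
  rw [extChartAt_to_inv] at h
  have : IsManifold 𝓘(ℝ, E) 1 U := IsManifold.of_le (n := ∞) (by simp)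
  refine h (ContinuousLinearMap.id ℝ E) (ContinuousLinearMap.id ℝ E) ?_ ?_ v
  · have e : (fun x : U => x * 1) = id := funext mul_one
    exact e ▸ hasMFDerivAt_id (I := 𝓘(ℝ, E)) (1 : U)
  · have := hasMFDerivAt_chart (E := E) (mem_chart_source E (1 : U))
    rw [mfderiv_extChartAt_self] at this
    exact this

theorem fderiv_mulInChart_unit_snd (v : E) :
    fderiv ℝ (mulInChart E U) (unitCoord E U, unitCoord E U) (0, v) = v := by
  have h := (eventually_fderiv_mulInChart_Ad (E := E) (U := U)).self_of_nhds v
  rw [extChartAt_to_inv, Ad_one] at h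
  exact h.symm.trans (fderiv_mulInChart_unit_fst v)

/-- Left-invariant vector fields in the chart at the identity. -/
theorem eventuallyEq_mpullback_mulInvariantVectorField (Y : GroupLieAlgebra 𝓘(ℝ, E) U) :
    ∀ᶠ y in nhds (unitCoord E U),
      VectorField.mpullbackWithin 𝓘(ℝ, E) 𝓘(ℝ, E) (extChartAt 𝓘(ℝ, E) (1 : U)).symm
        (mulInvariantVectorField Y) (Set.range 𝓘(ℝ, E)) y =
      fderiv ℝ (mulInChart E U) (y, unitCoord E U) ((0, Y) : E × E) := by
  have : IsManifold 𝓘(ℝ, E) 1 U := IsManifold.of_le (n := ∞) (by simp)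
  filter_upwards [eventually_fderiv_mulInChart_snd (E := E) (U := U),
    extChartAt_target_mem_nhds (I := 𝓘(ℝ, E)) (1 : U)] with y h2 hy
  set g := (extChartAt 𝓘(ℝ, E) (1 : U)).symm y with hg
  have hgs : g ∈ (chartAt E (1 : U)).source := by
    rw [← extChartAt_source 𝓘(ℝ, E)]; exact (extChartAt 𝓘(ℝ, E) (1 : U)).map_target hy
  have hB := hasMFDerivAt_chart hgs
  have hL := hasMFDerivAt_mul_left (E := E) g 1
  refine Eq.trans ?_ (h2 _ _ hL hB Y).symm
  rw [VectorField.mpullbackWithin_apply, ContinuousLinearMap.inverse_eq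
    (mfderivWithin_extChartAt_symm_comp_mfderiv_extChartAt hy)
    (mfderiv_extChartAt_comp_mfderivWithin_extChartAt_symm hy)]
  rfl

theorem differentiableAt_Ad_chart :
    DifferentiableAt ℝ (fun y => Ad E ((extChartAt 𝓘(ℝ, E) (1 : U)).symm y)) (unitCoord E U) := by
  have h1 : ContMDiffAt 𝓘(ℝ, E) 𝓘(ℝ, E) ∞ (extChartAt 𝓘(ℝ, E) (1 : U)).symm (unitCoord E U) :=
    (contMDiffOn_extChartAt_symm (1 : U)).contMDiffAt (extChartAt_target_mem_nhds (1 : U))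
  have h2 := (contMDiff_Ad (E := E) (U := U)).contMDiffAt.comp (unitCoord E U) h1
  exact (contMDiffAt_iff_contDiffAt.1 h2).differentiableAt (by simp)

variable (E U) in
/-- The second derivative at the identity of the multiplication read in the chart. -/
def mulSecondDeriv : E × E →L[ℝ] E × E →L[ℝ] E :=
  fderiv ℝ (fderiv ℝ (mulInChart E U)) (unitCoord E U, unitCoord E U)

theorem hasFDerivAt_fderiv_mulInChart :
    HasFDerivAt (fderiv ℝ (mulInChart E U)) (mulSecondDeriv E U)
      (unitCoord E U, unitCoord E U) :=
  (((contDiffAt_mulInChart (E := E) (U := U)).fderiv_right (m := 1) (n := ∞)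
    (by norm_cast)).differentiableAt (by simp)).hasFDerivAt

theorem mulSecondDeriv_symm (v w : E × E) :
    mulSecondDeriv E U v w = mulSecondDeriv E U w v :=
  ((contDiffAt_mulInChart (E := E) (U := U)).isSymmSndFDerivAt
    (by rw [minSmoothness_of_isRCLikeNormedField]; norm_cast)).eq v w

theorem hasFDerivAt_leftInvariant_chart (Z : E) : HasFDerivAt
      (fun y => fderiv ℝ (mulInChart E U) (y, unitCoord E U) (0, Z))
      ((ContinuousLinearMap.apply ℝ E ((0, Z) : E × E)).comp
        ((mulSecondDeriv E U).comp (ContinuousLinearMap.inl ℝ E E))) (unitCoord E U) :=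
  (ContinuousLinearMap.apply ℝ E ((0, Z) : E × E)).hasFDerivAt.comp (unitCoord E U)
    (HasFDerivAt.comp (f := fun z => (z, unitCoord E U)) (unitCoord E U)
      hasFDerivAt_fderiv_mulInChart
      (hasFDerivAt_prodMk_left (unitCoord E U) (unitCoord E U)))

theorem lieBracket_leftInvariant_chart (X Y : E) :
    VectorField.lieBracket ℝ
      (fun y => fderiv ℝ (mulInChart E U) (y, unitCoord E U) (0, X))
      (fun y => fderiv ℝ (mulInChart E U) (y, unitCoord E U) (0, Y)) (unitCoord E U) =
    mulSecondDeriv E U (X, 0) (0, Y) - mulSecondDeriv E U (Y, 0) (0, X) := by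
  rw [VectorField.lieBracket, (hasFDerivAt_leftInvariant_chart Y).fderiv,
    (hasFDerivAt_leftInvariant_chart X).fderiv, fderiv_mulInChart_unit_snd,
    fderiv_mulInChart_unit_snd]
  rfl

/-- With `m` the multiplication in the chart, `∂₁m(1, y)(Ad(y) Y) = ∂₂m(y, 1)(Y)`. Differentiating
in `y` at the unit along `X` and using the symmetry of the second derivative of `m` gives the
formula. -/
theorem fderiv_Ad_chart_eq (X Y : E) :
    (fderiv ℝ (fun y => Ad E ((extChartAt 𝓘(ℝ, E) (1 : U)).symm y)) (unitCoord E U) X) Y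
      = mulSecondDeriv E U (X, 0) (0, Y) - mulSecondDeriv E U (Y, 0) (0, X) := by
  have ha := (differentiableAt_Ad_chart (E := E) (U := U)).hasFDerivAt
  have hr := hasFDerivAt_leftInvariant_chart (E := E) (U := U) Y
  have hv : HasFDerivAt (fun y => ((Ad E ((extChartAt 𝓘(ℝ, E) (1 : U)).symm y) Y, 0) : E × E))
      ((ContinuousLinearMap.inl ℝ E E).comp ((ContinuousLinearMap.apply ℝ E Y).comp
        (fderiv ℝ (fun y => Ad E ((extChartAt 𝓘(ℝ, E) (1 : U)).symm y)) (unitCoord E U))))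
        (unitCoord E U) :=
    (ContinuousLinearMap.inl ℝ E E).hasFDerivAt.comp (unitCoord E U)
      ((ContinuousLinearMap.apply ℝ E Y).hasFDerivAt.comp (unitCoord E U) ha)
  have hl := (HasFDerivAt.comp (f := fun z => (unitCoord E U, z)) (unitCoord E U)
    hasFDerivAt_fderiv_mulInChart
      (hasFDerivAt_prodMk_right (unitCoord E U) (unitCoord E U))).clm_apply hv
  have h1 : (extChartAt 𝓘(ℝ, E) (1 : U)).symm (unitCoord E U) = 1 := extChartAt_to_inv _
  rw [h1, Ad_one] at hl
  have heq := (hr.congr_of_eventuallyEq ((eventually_fderiv_mulInChart_Ad (E := E) (U := U)).mono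
    fun y hy => hy Y)).unique hl
  have h : mulSecondDeriv E U (X, 0) (0, Y) = fderiv ℝ (mulInChart E U)
      (unitCoord E U, unitCoord E U) ((fderiv ℝ (fun y =>
        Ad E ((extChartAt 𝓘(ℝ, E) (1 : U)).symm y)) (unitCoord E U) X) Y, 0) +
      mulSecondDeriv E U (0, X) (Y, 0) := DFunLike.congr_fun heq X
  rw [h, mulSecondDeriv_symm (Y, 0) (0, X), fderiv_mulInChart_unit_fst, add_sub_cancel_right]

/-- The bracket of the Lie algebra of a Lie group through the second derivative of the
multiplication in the chart at the identity. -/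
theorem groupLieAlgebra_bracket_eq (X Y : GroupLieAlgebra 𝓘(ℝ, E) U) :
    ⁅X, Y⁆ = (mulSecondDeriv E U ((X, 0) : E × E) ((0, Y) : E × E) : E) -
      mulSecondDeriv E U ((Y, 0) : E × E) ((0, X) : E × E) := by
  have : IsManifold 𝓘(ℝ, E) 1 U := IsManifold.of_le (n := ∞) (by simp)
  have h1 := Filter.EventuallyEq.lieBracketWithin_vectorField_eq_nhds (𝕜 := ℝ) (E := E)
    (s := (extChartAt 𝓘(ℝ, E) (1 : U)).symm ⁻¹' Set.univ ∩ Set.range 𝓘(ℝ, E))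
    (eventuallyEq_mpullback_mulInvariantVectorField X)
    (eventuallyEq_mpullback_mulInvariantVectorField Y)
  have hs : (extChartAt 𝓘(ℝ, E) (1 : U)).symm ⁻¹' Set.univ ∩ Set.range 𝓘(ℝ, E) = Set.univ := by
    simp
  have h2 := congrArg (fun s => VectorField.lieBracketWithin ℝ
    (fun y => fderiv ℝ (mulInChart E U) (y, unitCoord E U) ((0, X) : E × E))
    (fun y => fderiv ℝ (mulInChart E U) (y, unitCoord E U) ((0, Y) : E × E)) s
    (unitCoord E U)) hs
  have h3 := congrFun (VectorField.lieBracketWithin_univ (𝕜 := ℝ)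
    (V := fun y => fderiv ℝ (mulInChart E U) (y, unitCoord E U) ((0, X) : E × E))
    (W := fun y => fderiv ℝ (mulInChart E U) (y, unitCoord E U) ((0, Y) : E × E))) (unitCoord E U)
  rw [GroupLieAlgebra.bracket_def, ← VectorField.mlieBracketWithin_univ,
    VectorField.mlieBracketWithin_apply, mfderiv_extChartAt_self]
  refine (DFunLike.congr_fun (ContinuousLinearMap.inverse_id (R := ℝ) (M := E)) _).trans ?_
  exact h1.trans (h2.trans (h3.trans (lieBracket_leftInvariant_chart (E := E) (U := U) X Y)))

/-- The derivative of the adjoint action at the identity is the adjoint representation of the Lie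
algebra. -/
theorem fderiv_Ad_chart (X Y : GroupLieAlgebra 𝓘(ℝ, E) U) :
    (fderiv ℝ (fun y => Ad E ((extChartAt 𝓘(ℝ, E) (1 : U)).symm y)) (unitCoord E U) : E → _)
      X Y = ⁅X, Y⁆ :=
  (fderiv_Ad_chart_eq (E := E) (U := U) X Y).trans (groupLieAlgebra_bracket_eq X Y).symm

end AdjointDerivative

/-! ### One-parameter subgroups and the adjoint action along them -/

section OneParameter

variable {E : Type*} [NormedAddCommGroup E] [NormedSpace ℝ E]
  {U : Type*} [TopologicalSpace U] [ChartedSpace E U] [Group U] [LieGroup 𝓘(ℝ, E) ∞ U]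

variable (E U) in
/-- The adjoint representation of the Lie algebra of a Lie group, as the derivative of the adjoint
action of the group. -/
def adL : E →L[ℝ] E →L[ℝ] E :=
  fderiv ℝ (fun y => Ad E ((extChartAt 𝓘(ℝ, E) (1 : U)).symm y)) (unitCoord E U)

theorem adL_apply (X Y : GroupLieAlgebra 𝓘(ℝ, E) U) : (adL E U : E → _) X Y = ⁅X, Y⁆ :=
  fderiv_Ad_chart X Y

theorem hasDerivAt_Ad_comp {γ : ℝ → U} {X : E} (hγ : γ 0 = 1)
    (hX : HasMFDerivAt 𝓘(ℝ, ℝ) 𝓘(ℝ, E) γ 0 (ContinuousLinearMap.toSpanSingleton ℝ X)) :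
    HasDerivAt (fun s => Ad E (γ s)) (adL E U X) 0 := by
  have : IsManifold 𝓘(ℝ, E) 1 U := IsManifold.of_le (n := ∞) (by simp)
  have h1 := hasMFDerivAt_chart (E := E) (mem_chart_source E (1 : U))
  rw [mfderiv_extChartAt_self] at h1
  have h1' : HasMFDerivAt 𝓘(ℝ, E) 𝓘(ℝ, E) (extChartAt 𝓘(ℝ, E) (1 : U)) (γ 0)
      (ContinuousLinearMap.id ℝ E) := by rw [hγ]; exact h1
  have h2 := hasMFDerivAt_iff_hasFDerivAt.1 (h1'.comp 0 hX)
  have h3 := (differentiableAt_Ad_chart (E := E) (U := U)).hasFDerivAt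
  have h3' : HasFDerivAt (fun y => Ad E ((extChartAt 𝓘(ℝ, E) (1 : U)).symm y)) (adL E U)
      ((extChartAt 𝓘(ℝ, E) (1 : U) ∘ γ) 0) := by
    rw [Function.comp_apply, hγ]; exact h3
  have h4 := HasFDerivAt.comp (0 : ℝ) h3' h2
  have h5 := h4.hasDerivAt
  have h6 : HasDerivAt ((fun y => Ad E ((extChartAt 𝓘(ℝ, E) (1 : U)).symm y)) ∘
      (extChartAt 𝓘(ℝ, E) (1 : U) ∘ γ)) (adL E U X) 0 := by
    convert! h5 using 1
    exact congrArg (adL E U) (one_smul ℝ X).symm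
  refine h6.congr_of_eventuallyEq ?_
  have hs : ∀ᶠ s in nhds (0 : ℝ), γ s ∈ (extChartAt 𝓘(ℝ, E) (1 : U)).source :=
    hX.continuousAt.eventually (by rw [hγ]; exact extChartAt_source_mem_nhds (1 : U))
  filter_upwards [hs] with s hs
  simp only [Function.comp_apply]
  rw [(extChartAt 𝓘(ℝ, E) (1 : U)).left_inv hs]

/-- The equality in the tangent bundle carries two facts: its base component says that `γ 0 = 1`,
its fibre component gives the velocity. -/
theorem exists_oneParameter {T : Subgroup U} {X : GroupLieAlgebra 𝓘(ℝ, E) U}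
    (hX : X ∈ subgroupLieAlgebra E T) :
    ∃ γ : ℝ → U, γ 0 = 1 ∧ (∀ s t, γ (s + t) = γ s * γ t) ∧ (∀ t, γ t ∈ T) ∧
      HasMFDerivAt 𝓘(ℝ, ℝ) 𝓘(ℝ, E) γ 0 (ContinuousLinearMap.toSpanSingleton ℝ (X : E)) := by
  obtain ⟨γ, hsm, hadd, hT, hd⟩ := hX
  have h0 : γ 0 = 1 := congrArg Bundle.TotalSpace.proj hd
  refine ⟨γ, h0, hadd, hT, ?_⟩
  have h1 := ((hsm.mdifferentiable (by simp)) 0).hasMFDerivAt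
  have h2 : (mfderiv 𝓘(ℝ, ℝ) 𝓘(ℝ, E) γ 0 : ℝ → E) 1 = X :=
    eq_of_heq (Bundle.TotalSpace.mk.inj hd).2
  have h3 : ContinuousLinearMap.toSpanSingleton ℝ (X : E) =
      (mfderiv 𝓘(ℝ, ℝ) 𝓘(ℝ, E) γ 0 : ℝ →L[ℝ] E) := by
    ext
    exact (one_smul ℝ (X : E)).trans h2.symm
  exact hasMFDerivAt_congr_deriv h1 h3.symm

/-- Compactness of `U` enters here; the bound later makes the roots imaginary. -/
theorem exists_norm_Ad_le [CompactSpace U] : ∃ C, ∀ g : U, ‖Ad E g‖ ≤ C := by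
  obtain ⟨C, hC⟩ :=
    (isCompact_range (contMDiff_Ad (E := E) (U := U)).continuous).isBounded.exists_norm_le
  exact ⟨C, fun g => hC _ ⟨g, rfl⟩⟩

/-- Reduces to time `0` through `Ad(γ t) = Ad(γ s) ∘ Ad(γ (t - s))`. -/
theorem hasDerivAt_Ad_oneParameter {γ : ℝ → U} {X : E} (hγ : γ 0 = 1)
    (hadd : ∀ s t, γ (s + t) = γ s * γ t)
    (hX : HasMFDerivAt 𝓘(ℝ, ℝ) 𝓘(ℝ, E) γ 0 (ContinuousLinearMap.toSpanSingleton ℝ X)) (s : ℝ) :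
    HasDerivAt (fun s => Ad E (γ s)) ((Ad E (γ s)).comp (adL E U X)) s := by
  have h := hasDerivAt_Ad_comp hγ hX
  have h1 : HasDerivAt (fun t => Ad E (γ (t - s))) (adL E U X) s := by
    refine HasDerivAt.comp_sub_const (f := fun t => Ad E (γ t)) s s ?_
    rwa [sub_self]
  have h2 := (hasDerivAt_const s (Ad E (γ s))).clm_comp h1
  refine (h2.congr_deriv (by simp)).congr_of_eventuallyEq (Filter.Eventually.of_forall fun t => ?_)
  simp only
  rw [← Ad_mul, ← hadd, add_sub_cancel]

end OneParameter

/-! ### Local sections of submersions -/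

section Submersion

variable {E F : Type*} [NormedAddCommGroup E] [NormedSpace ℝ E] [NormedAddCommGroup F]
  [NormedSpace ℝ F]
  {M N : Type*} [TopologicalSpace M] [ChartedSpace E M] [TopologicalSpace N] [ChartedSpace F N]

/-- A smooth submersion has smooth local sections. -/
theorem exists_localSection {f : M → N} {x : M}
    (hf : Manifold.IsSubmersionAt 𝓘(ℝ, E) 𝓘(ℝ, F) ∞ f x) :
    ∃ σ : N → M, σ (f x) = x ∧ ContMDiffAt 𝓘(ℝ, F) 𝓘(ℝ, E) ∞ σ (f x) ∧
      ∀ᶠ y in nhds (f x), f (σ y) = y := by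
  set φ := hf.domChart with hφ
  set ψ := hf.codChart with hψ
  set e := hf.equiv with he
  have hw : ∀ z ∈ φ.target, ψ (f (φ.symm z)) = (e z).1 := by
    intro z hz
    have := hf.writtenInCharts
      (show z ∈ (hf.domChart.extend 𝓘(ℝ, E)).target by simpa using hz)
    simpa using this
  have hx := hf.mem_domChart_source
  -- In adapted charts `f` is a linear projection onto the first factor; the section freezes the
  -- second coordinate at its value at `x`.
  set τ : N → E := fun y => e.symm (ψ y, (e (φ x)).2) with hτ
  have hτx : τ (f x) = φ x := by
    have h := hw (φ x) (φ.map_source hx)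
    rw [φ.left_inv hx] at h
    simp only [hτ]
    rw [h, Prod.mk.eta, e.symm_apply_apply]
  have hψs : ContMDiffAt 𝓘(ℝ, F) 𝓘(ℝ, F) ∞ ψ (f x) :=
    contMDiffAt_of_mem_maximalAtlas hf.codChart_mem_maximalAtlas
      (hf.source_subset_preimage_source hx)
  have hτs : ContMDiffAt 𝓘(ℝ, F) 𝓘(ℝ, E) ∞ τ (f x) := by
    have : ContDiff ℝ ∞ (fun v : F => e.symm (v, (e (φ x)).2)) :=
      e.symm.contDiff.comp (contDiff_id.prodMk contDiff_const)
    exact this.contMDiff.contMDiffAt.comp (f x) hψs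
  refine ⟨fun y => φ.symm (τ y), ?_, ?_, ?_⟩
  · simp only [hτx]; exact φ.left_inv hx
  · have : ContMDiffAt 𝓘(ℝ, E) 𝓘(ℝ, E) ∞ φ.symm (τ (f x)) := by
      rw [hτx]
      exact contMDiffAt_symm_of_mem_maximalAtlas hf.domChart_mem_maximalAtlas (φ.map_source hx)
    exact this.comp (f x) hτs
  · have h1 : ∀ᶠ y in nhds (f x), τ y ∈ φ.target :=
      hτs.continuousAt.eventually (by rw [hτx]; exact φ.open_target.mem_nhds (φ.map_source hx))
    have h2 : ∀ᶠ y in nhds (f x), y ∈ ψ.source :=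
      ψ.open_source.mem_nhds (hf.source_subset_preimage_source hx)
    filter_upwards [h1, h2] with y hy hy'
    refine ψ.injOn (hf.source_subset_preimage_source (φ.map_target hy)) hy' ?_
    rw [hw _ hy]
    simp [hτ]

/-- The derivative of a submersion has a right inverse. -/
theorem exists_mfderiv_rightInverse {f : M → N} {x : M}
    (hf : Manifold.IsSubmersionAt 𝓘(ℝ, E) 𝓘(ℝ, F) ∞ f x) {P : E →L[ℝ] F}
    (hP : HasMFDerivAt 𝓘(ℝ, E) 𝓘(ℝ, F) f x P) :
    ∃ S : F →L[ℝ] E, P.comp S = ContinuousLinearMap.id ℝ F := by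
  obtain ⟨σ, h1, h2, h3⟩ := exists_localSection hf
  have h4 := (h2.mdifferentiableAt (by simp)).hasMFDerivAt
  have hP' : HasMFDerivAt 𝓘(ℝ, E) 𝓘(ℝ, F) f (σ (f x)) P := by rw [h1]; exact hP
  refine ⟨mfderiv 𝓘(ℝ, F) 𝓘(ℝ, E) σ (f x), ?_⟩
  have h5 := HasMFDerivAt.comp (f x) hP' h4
  have h6 := (hasMFDerivAt_id (I := 𝓘(ℝ, F)) (f x)).congr_of_eventuallyEq
    (f₁ := f ∘ σ) h3
  exact hasMFDerivAt_unique h5 h6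

end Submersion

/-! ### The projection to the homogeneous space and the isotropy representation -/

section Quotient

variable {E F : Type*} [NormedAddCommGroup E] [NormedSpace ℝ E] [NormedAddCommGroup F]
  [NormedSpace ℝ F]
  {U : Type*} [TopologicalSpace U] [ChartedSpace E U] [Group U] [LieGroup 𝓘(ℝ, E) ∞ U]
  {T : Subgroup U} [ChartedSpace F (U ⧸ T)]

/-- With a local section `σ` of the projection, the action is locally `y ↦ g σ(y) T`, a composite of
smooth maps. -/
theorem mdifferentiableAt_smul_quotient
    (hπ : Manifold.IsSubmersion 𝓘(ℝ, E) 𝓘(ℝ, F) ∞ (QuotientGroup.mk : U → U ⧸ T)) (g : U)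
    (x : U ⧸ T) : MDifferentiableAt 𝓘(ℝ, F) 𝓘(ℝ, F) (fun y : U ⧸ T => g • y) x := by
  obtain ⟨u, rfl⟩ := QuotientGroup.mk_surjective x
  obtain ⟨σ, h1, h2, h3⟩ := exists_localSection (hπ.isSubmersionAt u)
  have hπs := fun u : U => (hπ.isSubmersionAt u).contMDiffAt
  have h4 : ContMDiffAt 𝓘(ℝ, F) 𝓘(ℝ, F) ∞ (fun y => (QuotientGroup.mk (g * σ y) : U ⧸ T))
      (QuotientGroup.mk u) :=
    (hπs _).comp _ ((contMDiff_mul_left (a := g)).contMDiffAt.comp _ h2)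
  refine (h4.mdifferentiableAt (by simp)).congr_of_eventuallyEq ?_
  filter_upwards [h3] with y hy
  conv_lhs => rw [← hy]
  rfl

variable (E F T) in
/-- The derivative at the identity of the projection of a Lie group onto a homogeneous space. -/
def dproj : E →L[ℝ] F := mfderiv 𝓘(ℝ, E) 𝓘(ℝ, F) (QuotientGroup.mk : U → U ⧸ T) 1

variable (F T) in
/-- The isotropy representation: the derivative at the base point of the action of `g`. -/
def isotropy (g : U) : F →L[ℝ] F :=
  mfderiv 𝓘(ℝ, F) 𝓘(ℝ, F) (fun y : U ⧸ T => g • y) ((1 : U) : U ⧸ T)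

theorem hasMFDerivAt_dproj
    (hπ : Manifold.IsSubmersion 𝓘(ℝ, E) 𝓘(ℝ, F) ∞ (QuotientGroup.mk : U → U ⧸ T)) :
    HasMFDerivAt 𝓘(ℝ, E) 𝓘(ℝ, F) (QuotientGroup.mk : U → U ⧸ T) 1 (dproj E F T) :=
  ((hπ.isSubmersionAt 1).contMDiffAt.mdifferentiableAt (by simp)).hasMFDerivAt

theorem exists_dproj_rightInverse
    (hπ : Manifold.IsSubmersion 𝓘(ℝ, E) 𝓘(ℝ, F) ∞ (QuotientGroup.mk : U → U ⧸ T)) :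
    ∃ S : F →L[ℝ] E, (dproj E F T).comp S = ContinuousLinearMap.id ℝ F :=
  exists_mfderiv_rightInverse (hπ.isSubmersionAt 1) (hasMFDerivAt_dproj hπ)

/-- Differentiate `t • xT = (t x t⁻¹)T`, valid for `t ∈ T`, at `x = 1`. -/
theorem isotropy_comp_dproj
    (hπ : Manifold.IsSubmersion 𝓘(ℝ, E) 𝓘(ℝ, F) ∞ (QuotientGroup.mk : U → U ⧸ T)) {t : U}
    (ht : t ∈ T) :
    (isotropy F T t).comp (dproj E F T) = (dproj E F T).comp (Ad E t) := by
  have h1 := HasMFDerivAt.comp (1 : U)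
    (mdifferentiableAt_smul_quotient hπ t ((1 : U) : U ⧸ T)).hasMFDerivAt (hasMFDerivAt_dproj hπ)
  have h2 : HasMFDerivAt 𝓘(ℝ, E) 𝓘(ℝ, F) (QuotientGroup.mk : U → U ⧸ T) (t * 1 * t⁻¹)
      (dproj E F T) := by
    rw [mul_one, mul_inv_cancel]; exact hasMFDerivAt_dproj hπ
  have h3 := HasMFDerivAt.comp (1 : U) h2 (hasMFDerivAt_Ad t)
  have h4 : (fun y : U ⧸ T => t • y) ∘ (QuotientGroup.mk : U → U ⧸ T) =
      (QuotientGroup.mk : U → U ⧸ T) ∘ fun x : U => t * x * t⁻¹ := by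
    ext x
    refine QuotientGroup.eq.2 ?_
    simpa [mul_assoc] using ht
  rw [h4] at h1
  exact hasMFDerivAt_unique h1 h3

/-- A one-parameter subgroup inside `T` projects to a constant curve. -/
theorem dproj_eq_zero
    (hπ : Manifold.IsSubmersion 𝓘(ℝ, E) 𝓘(ℝ, F) ∞ (QuotientGroup.mk : U → U ⧸ T))
    {X : GroupLieAlgebra 𝓘(ℝ, E) U} (hX : X ∈ subgroupLieAlgebra E T) :
    (dproj E F T : E → F) X = 0 := by
  obtain ⟨γ, h0, -, hT, hd⟩ := exists_oneParameter hX
  have h2 : HasMFDerivAt 𝓘(ℝ, E) 𝓘(ℝ, F) (QuotientGroup.mk : U → U ⧸ T) (γ 0)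
      (dproj E F T) := by
    rw [h0]; exact hasMFDerivAt_dproj hπ
  have h3 := HasMFDerivAt.comp (0 : ℝ) h2 hd
  have h4 : (QuotientGroup.mk : U → U ⧸ T) ∘ γ = fun _ => ((1 : U) : U ⧸ T) := by
    ext s
    exact QuotientGroup.eq.2 (by simpa using hT s)
  rw [h4] at h3
  have h5 := hasMFDerivAt_unique h3 (hasMFDerivAt_const _ _)
  have h6 : (dproj E F T : E → F) ((1 : ℝ) • (X : E)) = 0 := DFunLike.congr_fun h5 (1 : ℝ)
  rwa [one_smul] at h6

/-- The derivatives of the action on a homogeneous space are multiplicative. -/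
theorem mfderiv_smul_comp
    (hπ : Manifold.IsSubmersion 𝓘(ℝ, E) 𝓘(ℝ, F) ∞ (QuotientGroup.mk : U → U ⧸ T)) (g h : U)
    (x : U ⧸ T) :
    (mfderiv 𝓘(ℝ, F) 𝓘(ℝ, F) (fun y : U ⧸ T => (g * h) • y) x : F →L[ℝ] F) =
      (mfderiv 𝓘(ℝ, F) 𝓘(ℝ, F) (fun y : U ⧸ T => g • y) (h • x) : F →L[ℝ] F).comp
      (mfderiv 𝓘(ℝ, F) 𝓘(ℝ, F) (fun y : U ⧸ T => h • y) x) := by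
  have h1 := HasMFDerivAt.comp x (mdifferentiableAt_smul_quotient hπ g (h • x)).hasMFDerivAt
    (mdifferentiableAt_smul_quotient hπ h x).hasMFDerivAt
  have h4 : (fun y : U ⧸ T => g • y) ∘ (fun y : U ⧸ T => h • y) =
      fun y : U ⧸ T => (g * h) • y := by
    ext y; simp [mul_smul]
  rw [h4] at h1
  exact h1.mfderiv

theorem mfderiv_one_smul (x : U ⧸ T) :
    (mfderiv 𝓘(ℝ, F) 𝓘(ℝ, F) (fun y : U ⧸ T => (1 : U) • y) x : F →L[ℝ] F) =
      ContinuousLinearMap.id ℝ F := by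
  have : (fun y : U ⧸ T => (1 : U) • y) = id := by ext; simp
  have h := hasMFDerivAt_id (I := 𝓘(ℝ, F)) x
  rw [← this] at h
  exact h.mfderiv

end Quotient

/-! ### Parity from the absence of real eigenvalues -/

section EvenDimension

open Polynomial

/-- A real polynomial without real roots has even degree. -/
theorem even_natDegree_of_no_root {P : ℝ[X]} (hlc : 0 ≤ P.leadingCoeff)
    (h : ∀ x, ¬ P.IsRoot x) : Even P.natDegree := by
  -- Without roots, `0` lies both to the right and to the left of every root, so `P(0)` and
  -- `(-1)^deg P(0)` are both positive.
  have h1 := zero_lt_eval_of_roots_lt_of_leadingCoeff_nonneg (P := P) (x := 0)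
    (fun y hy => absurd hy (h y)) hlc
  have h2 := zero_lt_negOnePow_mul_eval_of_lt_roots_of_leadingCoeff_nonneg (P := P) (x := 0)
    (fun y hy => absurd hy (h y)) hlc
  by_contra hodd
  rw [Nat.not_even_iff_odd] at hodd
  rw [Int.negOnePow_odd _ (by exact_mod_cast hodd)] at h2
  push_cast at h2
  linarith

/-- A real vector space with an endomorphism without real eigenvalues has even dimension. -/
theorem even_finrank_of_no_eigenvalue {W : Type*} [AddCommGroup W] [Module ℝ W]
    [FiniteDimensional ℝ W] (f : Module.End ℝ W) (h : ∀ μ, ¬ f.HasEigenvalue μ) :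
    Even (Module.finrank ℝ W) := by
  rw [← LinearMap.charpoly_natDegree f]
  refine even_natDegree_of_no_root ?_ fun x hx =>
    h x ((Module.End.hasEigenvalue_iff_isRoot_charpoly f x).2 hx)
  rw [(LinearMap.charpoly_monic f).leadingCoeff]
  exact zero_le_one

/-- If `D` is annihilated by a real polynomial without real roots, then every subspace of `V ⊕ V*`
stable under `X + ξ ↦ D X - ξ ∘ D` has even dimension. -/
theorem even_finrank_of_stable {V : Type*} [NormedAddCommGroup V] [NormedSpace ℝ V]
    [FiniteDimensional ℝ V] (D : V →L[ℝ] V) {P : ℝ[X]} (hP : ∀ x, ¬ P.IsRoot x)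
    (hD : aeval (D : V →ₗ[ℝ] V) P = 0) (K : Submodule ℝ (Gen V))
    (hK : ∀ a ∈ K, ((D a.1, -(a.2.comp D)) : Gen V) ∈ K) : Even (Module.finrank ℝ K) := by
  have hfd : FiniteDimensional ℝ (V →L[ℝ] ℝ) :=
    LinearMap.toContinuousLinearMap.finiteDimensional
  let M : Gen V →ₗ[ℝ] Gen V :=
    { toFun := fun a => (D a.1, -(a.2.comp D))
      map_add' := fun a b => by ext <;> simp [add_comm]
      map_smul' := fun r a => by ext <;> simp }
  -- A real eigenvector `(v, ξ)` for `μ` satisfies `D v = μ v` and `ξ ∘ D = -μ ξ`. Applying `P(D) =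
  -- 0` yields `P(μ) v = 0` and `P(-μ) ξ = 0`, so both components vanish.
  refine even_finrank_of_no_eigenvalue (W := K) (M.restrict (p := K) (q := K) hK) fun μ hμ => ?_
  obtain ⟨⟨⟨v, ξ⟩, haK⟩, ha⟩ := hμ.exists_hasEigenvector
  have h1 : M (v, ξ) = μ • (v, ξ) := congrArg Subtype.val ha.apply_eq_smul
  have hv : D v = μ • v := congrArg Prod.fst h1
  have hξ : -(ξ.comp D) = μ • ξ := congrArg Prod.snd h1
  have hv0 : v = 0 := by
    by_contra hne
    have h2 : Module.End.HasEigenvector (D : V →ₗ[ℝ] V) μ v :=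
      ⟨Module.End.mem_eigenspace_iff.2 hv, hne⟩
    have h3 := Module.End.aeval_apply_of_hasEigenvector (p := P) h2
    rw [hD] at h3
    exact hP μ ((smul_eq_zero.1 h3.symm).resolve_right hne)
  have hξ0 : ξ = 0 := by
    have h2 : ∀ w, ξ (D w) = (-μ) * ξ w := fun w => by
      have := DFunLike.congr_fun hξ w
      simp at this
      linarith
    have h3 : ∀ (Q : ℝ[X]) (w : V), ξ (aeval (D : V →ₗ[ℝ] V) Q w) = Q.eval (-μ) * ξ w := by
      intro Q
      induction Q using Polynomial.induction_on' with
      | add p q hp hq => intro w; simp [hp, hq, add_mul]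
      | monomial n a =>
        induction n with
        | zero => intro w; simp [Module.algebraMap_end_apply]
        | succ n ih =>
          intro w
          have := ih (D w)
          rw [h2] at this
          simp only [aeval_monomial, eval_monomial, pow_succ, Module.End.mul_apply] at this ⊢
          exact this.trans (by ring)
    ext w
    have h4 := h3 P w
    rw [hD] at h4
    simp only [LinearMap.zero_apply, map_zero] at h4
    exact (mul_eq_zero.1 h4.symm).resolve_left (hP _)
  exact ha.2 (Subtype.ext (Prod.ext hv0 hξ0))

end EvenDimension

/-! ### Real points of complex subspaces of the generalized tangent space -/

section RealPart

variable {V : Type*} [NormedAddCommGroup V] [NormedSpace ℝ V]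

/-- The real points of a complex subspace of `(V ⊕ V*) ⊗ ℂ`. -/
def realPart (L : Submodule ℂ (CGen V)) : Submodule ℝ (Gen V) :=
  (L.restrictScalars ℝ).comap (TensorProduct.mk ℝ ℂ (Gen V) 1)

theorem mem_realPart {L : Submodule ℂ (CGen V)} {a : Gen V} :
    a ∈ realPart L ↔ (1 : ℂ) ⊗ₜ[ℝ] a ∈ L := Iff.rfl

theorem conj_tmul (z : ℂ) (a : Gen V) : conj V (z ⊗ₜ[ℝ] a) = (starRingEnd ℂ z) ⊗ₜ[ℝ] a := rfl

theorem conj_conj (z : CGen V) : conj V (conj V z) = z := by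
  induction z using TensorProduct.induction_on with
  | zero => simp
  | tmul z a => simp [conj_tmul]
  | add x y hx hy => rw [map_add, map_add, hx, hy]

theorem exists_eq_re_add_im {W : Type*} [AddCommGroup W] [Module ℝ W] (z : ℂ ⊗[ℝ] W) :
    ∃ a b : W, z = (1 : ℂ) ⊗ₜ[ℝ] a + Complex.I • ((1 : ℂ) ⊗ₜ[ℝ] b) := by
  induction z using TensorProduct.induction_on with
  | zero => exact ⟨0, 0, by simp⟩
  | tmul z a =>
    refine ⟨z.re • a, z.im • a, ?_⟩
    rw [← TensorProduct.smul_tmul, ← TensorProduct.smul_tmul, TensorProduct.smul_tmul',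
      ← TensorProduct.add_tmul]
    congr 1
    apply Complex.ext <;> simp
  | add x y hx hy =>
    obtain ⟨a, b, rfl⟩ := hx
    obtain ⟨c, d, rfl⟩ := hy
    exact ⟨a + c, b + d, by simp only [TensorProduct.tmul_add, smul_add]; abel⟩

/-- If `z = a + ib` and `conj z = a - ib` both lie in `L`, so do `a = (z + conj z)/2` and `b = -i(z
- a)`. -/
theorem inf_conj_eq_baseChange (L : Submodule ℂ (CGen V)) :
    (L ⊓ L.map (conj V) : Submodule ℂ (CGen V)) = (realPart L).baseChange ℂ := by
  apply le_antisymm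
  · rintro z ⟨hz, w, hw, hwz⟩
    have hw' : conj V z = w := by rw [← hwz, conj_conj]
    rw [← hw'] at hw
    obtain ⟨a, b, rfl⟩ := exists_eq_re_add_im z
    have hc : conj V ((1 : ℂ) ⊗ₜ[ℝ] a + Complex.I • ((1 : ℂ) ⊗ₜ[ℝ] b)) =
        (1 : ℂ) ⊗ₜ[ℝ] a - Complex.I • ((1 : ℂ) ⊗ₜ[ℝ] b) := by
      rw [map_add, LinearMap.map_smulₛₗ, conj_tmul, conj_tmul, map_one, Complex.conj_I, neg_smul,
        sub_eq_add_neg]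
    have hw2 : (1 : ℂ) ⊗ₜ[ℝ] a - Complex.I • ((1 : ℂ) ⊗ₜ[ℝ] b) ∈ L := hc ▸ hw
    have ha : (1 : ℂ) ⊗ₜ[ℝ] a ∈ L := by
      have := L.smul_mem (2⁻¹ : ℂ) (L.add_mem hz hw2)
      convert! this using 1
      module
    have hb : (1 : ℂ) ⊗ₜ[ℝ] b ∈ L := by
      have := L.smul_mem (-Complex.I) (L.sub_mem hz ha)
      convert! this using 1
      rw [add_sub_cancel_left, smul_smul]
      simp
    exact Submodule.add_mem _ (Submodule.tmul_mem_baseChange_of_mem 1 ha)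
      (Submodule.smul_mem _ _ (Submodule.tmul_mem_baseChange_of_mem 1 hb))
  · rw [Submodule.baseChange_eq_span, Submodule.span_le]
    rintro _ ⟨a, ha, rfl⟩
    exact ⟨ha, _, ha, by rw [TensorProduct.mk_apply, conj_tmul, map_one]⟩

theorem finrank_baseChange_submodule {W : Type*} [AddCommGroup W] [Module ℝ W]
    (K : Submodule ℝ W) : Module.finrank ℂ (K.baseChange ℂ) = Module.finrank ℝ K := by
  have h1 : K.baseChange ℂ = LinearMap.range (K.subtype.baseChange ℂ) := rfl
  rw [h1, LinearMap.finrank_range_of_inj, Module.finrank_baseChange]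
  exact Module.Flat.lTensor_preserves_injective_linearMap (M := ℂ) K.subtype K.injective_subtype

theorem realIndex_eq_finrank_realPart (L : Submodule ℂ (CGen V)) :
    realIndex L = Module.finrank ℝ (realPart L) := by
  rw [realIndex, inf_conj_eq_baseChange, finrank_baseChange_submodule]

theorem pairing_eq_zero_of_mem_realPart {L : Submodule ℂ (CGen V)} (hL : IsIsotropic L)
    {a b : Gen V} (ha : a ∈ realPart L) (hb : b ∈ realPart L) : pairing V a b = 0 := by
  have h := hL _ ha _ hb
  simpa [pairingC, LinearMap.BilinForm.baseChange_tmul] using h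

theorem pairing_apply (a b : Gen V) : pairing V a b = (1 / 2 : ℝ) * (a.2 b.1 + b.2 a.1) := rfl

theorem finrank_dual_clm [FiniteDimensional ℝ V] :
    Module.finrank ℝ (V →L[ℝ] ℝ) = Module.finrank ℝ V := by
  rw [← LinearMap.toContinuousLinearMap.finrank_eq]
  exact Subspace.dual_finrank_eq

/-- The pairing is nondegenerate on a space of dimension `2 dim V`, and the real points lie in their
own orthogonal complement. -/
theorem finrank_realPart_le [FiniteDimensional ℝ V] {L : Submodule ℂ (CGen V)}
    (hL : IsIsotropic L) : Module.finrank ℝ (realPart L) ≤ Module.finrank ℝ V := by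
  have hfd : FiniteDimensional ℝ (V →L[ℝ] ℝ) :=
    LinearMap.toContinuousLinearMap.finiteDimensional
  have hnd : (pairing V).Nondegenerate := by
    have key : ∀ a : Gen V, (∀ b, pairing V a b = 0) → a = 0 := by
      rintro ⟨v, ξ⟩ h
      have hξ : ξ = 0 := by
        ext w
        simpa [pairing_apply] using h (w, 0)
      have hv : v = 0 := by
        by_contra hne
        obtain ⟨η, hη⟩ := SeparatingDual.exists_ne_zero (R := ℝ) hne
        exact hη (by simpa [pairing_apply] using h (0, η))
      rw [hv, hξ]; rfl
    refine ⟨key, fun a h => key a fun b => ?_⟩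
    rw [pairing_apply, add_comm, ← pairing_apply]
    exact h b
  have h1 := LinearMap.BilinForm.finrank_orthogonal hnd (realPart L)
  have h2 : realPart L ≤ (pairing V).orthogonal (realPart L) := fun a ha b hb =>
    pairing_eq_zero_of_mem_realPart hL hb ha
  have h3 := Submodule.finrank_mono h2
  rw [h1, Module.finrank_prod, finrank_dual_clm] at h3
  omega

theorem pushGen_mem_realPart {A : V →L[ℝ] V} {L L' : Submodule ℂ (CGen V)}
    (h : L.map (pushGenC A) = L') {a : Gen V} (ha : a ∈ realPart L) :
    pushGen A a ∈ realPart L' := by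
  rw [mem_realPart, ← h]
  exact ⟨_, ha, rfl⟩

/-- The two-sided inverse `B` ensures that `A.inverse` in `pushGen` is a true inverse and not the
default value `0`; `pushGen A` is then injective on real points. -/
theorem finrank_realPart_le_of_map [FiniteDimensional ℝ V] {A B : V →L[ℝ] V}
    (hAB : A.comp B = ContinuousLinearMap.id ℝ V) (hBA : B.comp A = ContinuousLinearMap.id ℝ V)
    {L L' : Submodule ℂ (CGen V)} (h : L.map (pushGenC A) = L') :
    Module.finrank ℝ (realPart L) ≤ Module.finrank ℝ (realPart L') := by
  have hfd : FiniteDimensional ℝ (V →L[ℝ] ℝ) :=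
    LinearMap.toContinuousLinearMap.finiteDimensional
  have hinv : A.inverse = B := ContinuousLinearMap.inverse_eq hAB hBA
  have hinj : Function.Injective (pushGen A) := by
    rw [injective_iff_map_eq_zero]
    rintro ⟨v, ξ⟩ h
    have h1 : A v = 0 := congrArg Prod.fst h
    have h2 : ξ.comp A.inverse = 0 := congrArg Prod.snd h
    rw [hinv] at h2
    have h3 : v = 0 := by
      have := DFunLike.congr_fun hBA v
      simpa [h1] using this.symm
    have h4 : ξ = 0 := by
      have : (ξ.comp B).comp A = 0 := by rw [h2]; rfl
      rwa [ContinuousLinearMap.comp_assoc, hBA, ContinuousLinearMap.comp_id] at this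
    rw [h3, h4]; rfl
  exact LinearMap.finrank_le_finrank_of_injective
    (f := (pushGen A).restrict (p := realPart L) (q := realPart L')
      fun a ha => pushGen_mem_realPart h ha)
    fun a b hab => Subtype.ext (hinj (congrArg Subtype.val hab))

end RealPart

/-! ### Bounded linear flows have imaginary eigenvalues -/

section BoundedFlow

/-- A nonzero bounded solution on the whole line of `f' = μ f` exists only for imaginary `μ`. -/
theorem re_eq_zero_of_bounded_exp {f : ℝ → ℂ} {μ : ℂ} (hf : ∀ s, HasDerivAt f (μ * f s) s)
    {C : ℝ} (hC : ∀ s, ‖f s‖ ≤ C) (h0 : f 0 ≠ 0) : μ.re = 0 := by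
  have hexp : ∀ s : ℝ, HasDerivAt (fun s : ℝ => Complex.exp (-μ * s))
      (Complex.exp (-μ * s) * -μ) s := by
    intro s
    have h := (Complex.ofRealCLM.hasDerivAt (x := s)).const_mul (-μ)
    simpa using h.cexp
  have hconst : ∀ s, f s * Complex.exp (-μ * s) = f 0 := by
    have hd : ∀ s, HasDerivAt (fun s : ℝ => f s * Complex.exp (-μ * s)) 0 s := fun s =>
      ((hf s).mul (hexp s)).congr_deriv (by ring)
    intro s
    have := is_const_of_deriv_eq_zero (fun s => (hd s).differentiableAt) (fun s => (hd s).deriv) s 0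
    simpa using this
  by_contra hr
  -- At time `n / Re μ`, whatever the sign of `Re μ`, the norm of `f` is `‖f 0‖ eⁿ ≥ ‖f 0‖ (n + 1)`,
  -- which exceeds `C` for this `n`.
  obtain ⟨n, hn⟩ := exists_nat_gt (C / ‖f 0‖)
  have h1 := hconst (n / μ.re)
  have h2 : ‖f (n / μ.re)‖ * Real.exp (-n) = ‖f 0‖ := by
    rw [← h1, norm_mul, Complex.norm_exp]
    congr 2
    simp
    field_simp
  have hpos : 0 < ‖f 0‖ := norm_pos_iff.2 h0
  have h3 : ‖f 0‖ * Real.exp n ≤ C := by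
    rw [← h2, mul_assoc, ← Real.exp_add, neg_add_cancel, Real.exp_zero, mul_one]
    exact hC _
  have h4 := Real.add_one_le_exp (n : ℝ)
  rw [div_lt_iff₀ hpos] at hn
  nlinarith

/-- Let `A` be a bounded one-parameter family with `A' = A ∘ B`. Then the eigenvalues of the
complexification of `B` are imaginary. -/
theorem re_eq_zero_of_bounded_flow {E : Type*} [NormedAddCommGroup E] [NormedSpace ℝ E]
    {A : ℝ → E →L[ℝ] E} {B : E →L[ℝ] E} (hA : ∀ s, HasDerivAt A ((A s).comp B) s)
    (hA0 : A 0 = ContinuousLinearMap.id ℝ E) {C : ℝ} (hC : ∀ s, ‖A s‖ ≤ C) {μ : ℂ} {a b : E}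
    (ha : B a = μ.re • a - μ.im • b) (hb : B b = μ.im • a + μ.re • b) (hab : a ≠ 0 ∨ b ≠ 0) :
    μ.re = 0 := by
  -- The vector `a + ib` is an eigenvector of the complexified `B`. A real functional `ℓ` not
  -- vanishing on both parts turns the flow into the scalar function `ℓ(A_s a) + i ℓ(A_s b)`, which
  -- solves `f' = μ f`.
  obtain ⟨ℓ, hℓ⟩ : ∃ ℓ : E →L[ℝ] ℝ, ℓ a ≠ 0 ∨ ℓ b ≠ 0 := by
    rcases hab with h | h <;> obtain ⟨ℓ, hℓ⟩ := SeparatingDual.exists_ne_zero (R := ℝ) h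
    exacts [⟨ℓ, Or.inl hℓ⟩, ⟨ℓ, Or.inr hℓ⟩]
  have hd : ∀ (v : E) (s : ℝ), HasDerivAt (fun s => ((ℓ (A s v) : ℝ) : ℂ)) (ℓ (A s (B v)) : ℝ) s :=
    fun v s => (ℓ.hasFDerivAt.comp_hasDerivAt s
      (((hA s).clm_apply (hasDerivAt_const s v)).congr_deriv (by simp))).ofReal_comp
  refine re_eq_zero_of_bounded_exp (f := fun s => (ℓ (A s a) : ℂ) + Complex.I * (ℓ (A s b) : ℂ))
    (C := ‖ℓ‖ * (C * ‖a‖) + ‖ℓ‖ * (C * ‖b‖)) (μ := μ) (fun s => ?_) (fun s => ?_) ?_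
  · refine ((hd a s).add ((hd b s).const_mul Complex.I)).congr_deriv ?_
    rw [ha, hb]
    apply Complex.ext
    · simp
    · simp [add_comm]
  · have hv : ∀ v, ‖((ℓ (A s v) : ℝ) : ℂ)‖ ≤ ‖ℓ‖ * (C * ‖v‖) := fun v => by
      rw [Complex.norm_real]
      exact (ℓ.le_opNorm _).trans (mul_le_mul_of_nonneg_left
        (((A s).le_opNorm v).trans (mul_le_mul_of_nonneg_right (hC s) (norm_nonneg _)))
        (norm_nonneg _))
    refine (norm_add_le _ _).trans (add_le_add (hv a) ?_)
    rw [norm_mul, Complex.norm_I, one_mul]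
    exact hv b
  · intro h
    rw [hA0] at h
    have h1 := congrArg Complex.re h
    have h2 := congrArg Complex.im h
    simp at h1 h2
    exact hℓ.elim (fun h => h h1) (fun h => h h2)

end BoundedFlow

/-! ### Counting roots -/

section Roots

variable {𝔤 : Type*} [LieRing 𝔤] [LieAlgebra ℂ 𝔤] [FiniteDimensional ℂ 𝔤]
  [LieAlgebra.IsSemisimple ℂ 𝔤] {𝔥 : LieSubalgebra ℂ 𝔤} [𝔥.IsCartanSubalgebra]

/-- Negation sends the non-positive roots injectively to positive ones. -/
theorem card_root_le (b : (LieAlgebra.IsKilling.rootSystem 𝔥).Base) :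
    Nat.card 𝔥.root ≤ 2 * numPosRoots b := by
  classical
  let := (LieAlgebra.IsKilling.rootSystem 𝔥).indexNeg
  have h1 : Nat.card 𝔥.root = Nat.card {α : 𝔥.root // b.IsPos α} +
      Nat.card {α : 𝔥.root // ¬ b.IsPos α} := by
    rw [← Nat.card_sum]
    exact Nat.card_congr (Equiv.sumCompl _).symm
  have h2 : Nat.card {α : 𝔥.root // ¬ b.IsPos α} ≤ Nat.card {α : 𝔥.root // b.IsPos α} :=
    Nat.card_le_card_of_injective
      (fun α => ⟨-α.1, (RootPairing.Base.IsPos.or_neg b α.1).resolve_left α.2⟩)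
      fun α β h => Subtype.ext (neg_injective (congrArg Subtype.val h))
  rw [numPosRoots]
  omega

/-- A linear map that vanishes on the Cartan subalgebra has rank at most the number of roots. -/
theorem finrank_range_le_card_root {W : Type*} [AddCommGroup W] [Module ℂ W] (Ψ : 𝔤 →ₗ[ℂ] W)
    (hΨ : ∀ z ∈ 𝔥, Ψ z = 0) : Module.finrank ℂ (LinearMap.range Ψ) ≤ Nat.card 𝔥.root := by
  -- Root spaces are lines, so one vector per root spans the image of `Ψ`.
  have hx : ∀ α : 𝔥.root, ∃ x : 𝔤, ∀ z ∈ LieAlgebra.rootSpace 𝔥 α.1, ∃ c : ℂ, c • x = z := by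
    intro α
    obtain ⟨x, -, hx⟩ := finrank_eq_one_iff'.1
      (LieAlgebra.IsKilling.finrank_rootSpace_eq_one α.1 (LieSubalgebra.isNonZero_coe_root α))
    exact ⟨x, fun z hz => (hx ⟨z, hz⟩).imp fun c hc => congrArg Subtype.val hc⟩
  choose x hx using hx
  have hspan : LinearMap.range Ψ ≤ Submodule.span ℂ (Set.range fun α => Ψ (x α)) := by
    have htop := congrArg LieSubmodule.toSubmodule
      (LieAlgebra.cartan_sup_iSup_rootSpace_eq_top 𝔥)
    rw [LinearMap.range_le_iff_comap, eq_top_iff]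
    refine (le_of_eq htop.symm).trans ?_
    simp only [LieSubmodule.sup_toSubmodule, LieSubmodule.iSup_toSubmodule, sup_le_iff, iSup_le_iff]
    refine ⟨fun z hz => ?_, fun α hα z hz => ?_⟩
    · rw [Submodule.mem_comap, hΨ z hz]; exact Submodule.zero_mem _
    · obtain ⟨c, rfl⟩ := hx ⟨α, by simpa using hα⟩ z hz
      rw [Submodule.mem_comap, map_smul]
      exact Submodule.smul_mem _ _ (Submodule.subset_span ⟨_, rfl⟩)
  have : Module.Finite ℂ (Submodule.span ℂ (Set.range fun α => Ψ (x α))) :=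
    Module.Finite.span_of_finite ℂ (Set.finite_range _)
  have h2 : Module.finrank ℂ (LinearMap.range Ψ) ≤ _ := Submodule.finrank_mono hspan
  rw [Nat.card_eq_fintype_card]
  exact h2.trans (finrank_range_le_card _)

end Roots

/-! ### Polynomials in `ad H` -/

section RegularElement

open Polynomial

theorem aeval_apply_of_apply_eq_smul {k V : Type*} [Field k] [AddCommGroup V] [Module k V]
    {A : Module.End k V} {z : V} {μ : k} (h : A z = μ • z) (Q : k[X]) :
    aeval A Q z = Q.eval μ • z := by
  by_cases hz : z = 0
  · simp [hz]
  · exact Module.End.aeval_apply_of_hasEigenvector ⟨Module.End.mem_eigenspace_iff.2 h, hz⟩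

/-- The field `K` is left free to serve two cases: `K = ℂ` for the inclusion of the real form, and
`K = ℝ` for the projection to the tangent space. -/
theorem map_aeval_of_intertwine {K V W : Type*} [Field K] [Algebra ℝ K] [AddCommGroup V]
    [Module ℝ V] [AddCommGroup W] [Module ℝ W] [Module K W] [IsScalarTower ℝ K W]
    {A : Module.End ℝ V} {B : Module.End K W} (θ : V →ₗ[ℝ] W)
    (h : ∀ v, θ (A v) = B (θ v)) (Q : ℝ[X]) (v : V) :
    θ (aeval A Q v) = aeval B (Q.map (algebraMap ℝ K)) (θ v) := by
  induction Q using Polynomial.induction_on' generalizing v with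
  | add p q hp hq => simp [hp, hq]
  | monomial n a =>
    induction n generalizing v with
    | zero => simp [Module.algebraMap_end_apply]
    | succ n ih =>
      have := ih (A v)
      rw [h] at this
      simpa only [aeval_monomial, map_monomial, pow_succ, Module.End.mul_apply] using this

variable {𝔤 : Type*} [LieRing 𝔤] [LieAlgebra ℂ 𝔤] [FiniteDimensional ℂ 𝔤]
  [LieAlgebra.IsSemisimple ℂ 𝔤] {𝔥 : LieSubalgebra ℂ 𝔤} [𝔥.IsCartanSubalgebra]

/-- If all roots vanish at `Q` on `H`, then `Q(ad H)` maps into the Cartan subalgebra. -/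
theorem aeval_ad_mem_cartan {H : 𝔤} (hH : H ∈ 𝔥) {Q : ℂ[X]}
    (hQ : ∀ α : 𝔥.root, Q.eval (α.1 ⟨H, hH⟩) = 0) (z : 𝔤) :
    aeval (LieAlgebra.ad ℂ 𝔤 H) Q z ∈ 𝔥 := by
  have htop := congrArg LieSubmodule.toSubmodule
    (LieAlgebra.cartan_sup_iSup_rootSpace_eq_top 𝔥)
  suffices h : (⊤ : Submodule ℂ 𝔤) ≤
      𝔥.toSubmodule.comap (aeval (LieAlgebra.ad ℂ 𝔤 H) Q) from h trivial
  refine (le_of_eq htop.symm).trans ?_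
  simp only [LieSubmodule.sup_toSubmodule, LieSubmodule.iSup_toSubmodule, sup_le_iff, iSup_le_iff]
  refine ⟨fun z hz => ?_, fun α hα z hz => ?_⟩
  -- The Cartan subalgebra is abelian, so on it `Q(ad H)` is the scalar `Q(0)`, which need not
  -- vanish; hence the conclusion is only membership in `𝔥`.
  · have h0 : LieAlgebra.ad ℂ 𝔤 H z = (0 : ℂ) • z := by
      rw [zero_smul, LieAlgebra.ad_apply]
      exact congrArg Subtype.val (trivial_lie_zero 𝔥 𝔥 ⟨H, hH⟩ ⟨z, hz⟩)
    rw [Submodule.mem_comap, aeval_apply_of_apply_eq_smul h0]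
    exact 𝔥.smul_mem _ hz
  · have h0 : LieAlgebra.ad ℂ 𝔤 H z = α ⟨H, hH⟩ • z :=
      LieAlgebra.IsKilling.lie_eq_smul_of_mem_rootSpace hz ⟨H, hH⟩
    rw [Submodule.mem_comap, aeval_apply_of_apply_eq_smul h0, hQ ⟨α, by simpa using hα⟩, zero_smul]
    exact 𝔥.zero_mem

end RegularElement

/-! ### Real forms and the choice of a regular element -/

section RealForm

open Polynomial

variable {𝔤 : Type*} [LieRing 𝔤] [LieAlgebra ℂ 𝔤] {𝔲 : Type*} [LieRing 𝔲] [LieAlgebra ℝ 𝔲]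

/-- The inclusion of a real form in a complex Lie algebra. -/
def realForm (e : (ℂ ⊗[ℝ] 𝔲) ≃ₗ⁅ℂ⁆ 𝔤) : 𝔲 →ₗ[ℝ] 𝔤 where
  toFun X := e ((1 : ℂ) ⊗ₜ[ℝ] X)
  map_add' X Y := by rw [TensorProduct.tmul_add, map_add]
  map_smul' r X := by
    rw [RingHom.id_apply, TensorProduct.tmul_smul, ← algebraMap_smul ℂ r, map_smul,
      algebraMap_smul]

theorem realForm_lie (e : (ℂ ⊗[ℝ] 𝔲) ≃ₗ⁅ℂ⁆ 𝔤) (X Y : 𝔲) :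
    realForm e ⁅X, Y⁆ = ⁅realForm e X, realForm e Y⁆ := by
  simp only [realForm, LinearMap.coe_mk, AddHom.coe_mk]
  rw [← LieEquiv.map_lie, LieAlgebra.ExtendScalars.bracket_tmul, one_mul]

/-- The base change of a real linear map on a real form of a complex Lie algebra. -/
def complexify {F : Type*} [AddCommGroup F] [Module ℝ F] (e : (ℂ ⊗[ℝ] 𝔲) ≃ₗ⁅ℂ⁆ 𝔤)
    (p : 𝔲 →ₗ[ℝ] F) : 𝔤 →ₗ[ℂ] ℂ ⊗[ℝ] F :=
  p.baseChange ℂ ∘ₗ (e.symm : 𝔤 →ₗ[ℂ] ℂ ⊗[ℝ] 𝔲)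

theorem complexify_realForm {F : Type*} [AddCommGroup F] [Module ℝ F]
    (e : (ℂ ⊗[ℝ] 𝔲) ≃ₗ⁅ℂ⁆ 𝔤) (p : 𝔲 →ₗ[ℝ] F) (X : 𝔲) :
    complexify e p (realForm e X) = (1 : ℂ) ⊗ₜ[ℝ] p X := by
  change p.baseChange ℂ (e.symm (e ((1 : ℂ) ⊗ₜ[ℝ] X))) = _
  rw [LieEquiv.symm_apply_apply, LinearMap.baseChange_tmul]

variable {𝔥 : LieSubalgebra ℂ 𝔤}

theorem complexify_eq_zero {F : Type*} [AddCommGroup F] [Module ℝ F]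
    (e : (ℂ ⊗[ℝ] 𝔲) ≃ₗ⁅ℂ⁆ 𝔤) {t : Set 𝔲}
    (hT : 𝔥.toSubmodule = Submodule.span ℂ (realForm e '' t)) {p : 𝔲 →ₗ[ℝ] F}
    (hp : ∀ X ∈ t, p X = 0) : ∀ z ∈ 𝔥, complexify e p z = 0 := by
  intro z hz
  have h1 : 𝔥.toSubmodule ≤ LinearMap.ker (complexify e p) := by
    rw [hT, Submodule.span_le]
    rintro _ ⟨X, hX, rfl⟩
    change complexify e p (realForm e X) = 0
    rw [complexify_realForm, hp X hX, TensorProduct.tmul_zero]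
  exact h1 hz

/-- The complexification of `p` kills `𝔥` and sends a real point `X` to `1 ⊗ p X`, from which `p X`
is read off. This avoids identifying the real points of `𝔥` with the real span of `t`. -/
theorem eq_zero_of_realForm_mem {F : Type*} [AddCommGroup F] [Module ℝ F]
    (e : (ℂ ⊗[ℝ] 𝔲) ≃ₗ⁅ℂ⁆ 𝔤) {t : Set 𝔲}
    (hT : 𝔥.toSubmodule = Submodule.span ℂ (realForm e '' t)) {p : 𝔲 →ₗ[ℝ] F}
    (hp : ∀ X ∈ t, p X = 0) {X : 𝔲} (hX : realForm e X ∈ 𝔥) : p X = 0 := by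
  have h := complexify_eq_zero e hT hp _ hX
  rw [complexify_realForm] at h
  have h2 := congrArg (fun z => TensorProduct.lid ℝ F (LinearMap.rTensor F Complex.reLm z)) h
  simpa using h2

theorem eq_zero_of_realForm_add_eq_zero (e : (ℂ ⊗[ℝ] 𝔲) ≃ₗ⁅ℂ⁆ 𝔤) {a b : 𝔲}
    (h : realForm e a + Complex.I • realForm e b = 0) : a = 0 ∧ b = 0 := by
  have h1 : e ((1 : ℂ) ⊗ₜ[ℝ] a + Complex.I • ((1 : ℂ) ⊗ₜ[ℝ] b)) = 0 := by
    rw [map_add, map_smul]; exact h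
  have h2 := e.injective (h1.trans (map_zero e).symm)
  rw [TensorProduct.smul_tmul', smul_eq_mul, mul_one] at h2
  have hre := congrArg (fun z => TensorProduct.lid ℝ 𝔲 (LinearMap.rTensor 𝔲 Complex.reLm z)) h2
  have him := congrArg (fun z => TensorProduct.lid ℝ 𝔲 (LinearMap.rTensor 𝔲 Complex.imLm z)) h2
  constructor
  · simpa using hre
  · simpa using him

/-- The real and imaginary parts of an eigenvector of `ad X`, for `X` in a real form. -/
theorem exists_re_im_of_eigenvector (e : (ℂ ⊗[ℝ] 𝔲) ≃ₗ⁅ℂ⁆ 𝔤) {X : 𝔲} {μ : ℂ} {z : 𝔤}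
    (hz : ⁅realForm e X, z⁆ = μ • z) (hz0 : z ≠ 0) :
    ∃ a b : 𝔲, ⁅X, a⁆ = μ.re • a - μ.im • b ∧ ⁅X, b⁆ = μ.im • a + μ.re • b ∧ (a ≠ 0 ∨ b ≠ 0) := by
  obtain ⟨a, b, hab⟩ := exists_eq_re_add_im (e.symm z)
  have hz' : z = realForm e a + Complex.I • realForm e b := by
    rw [← e.apply_symm_apply z, hab, map_add, map_smul]; rfl
  have h1 : realForm e (⁅X, a⁆ - (μ.re • a - μ.im • b)) +
      Complex.I • realForm e (⁅X, b⁆ - (μ.im • a + μ.re • b)) = 0 := by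
    rw [hz', lie_add, lie_smul, ← realForm_lie, ← realForm_lie] at hz
    have hr : ∀ (r : ℝ) (Y : 𝔲), realForm e (r • Y) = (r : ℂ) • realForm e Y := fun r Y => by
      rw [map_smul]; rfl
    have hμ : μ = μ.re + μ.im * Complex.I := (Complex.re_add_im μ).symm
    simp only [map_sub, map_add, hr]
    rw [sub_add_eq_add_sub, smul_sub, add_sub, hz]
    conv_lhs => enter [1, 1, 1]; rw [hμ]
    have hI : Complex.I * Complex.I = -1 := Complex.I_mul_I
    match_scalars
    · ring
    · linear_combination (μ.im : ℂ) * hI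
  obtain ⟨ha, hb⟩ := eq_zero_of_realForm_add_eq_zero e h1
  refine ⟨a, b, sub_eq_zero.1 ha, sub_eq_zero.1 hb, ?_⟩
  by_contra! hab0
  rw [hab0.1, hab0.2, map_zero, smul_zero, add_zero] at hz'
  exact hz0 hz'

variable [FiniteDimensional ℂ 𝔤]
  [LieAlgebra.IsSemisimple ℂ 𝔤] [𝔥.IsCartanSubalgebra]

/-- If the roots take imaginary values on a set of real points that spans the Cartan subalgebra,
then the span contains an element `X` for which some real polynomial in `ad X` without real roots
maps into the Cartan subalgebra. -/
theorem exists_regular_polynomial (e : (ℂ ⊗[ℝ] 𝔲) ≃ₗ⁅ℂ⁆ 𝔤) {t : Set 𝔲}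
    (hT : 𝔥.toSubmodule = Submodule.span ℂ (realForm e '' t))
    (him : ∀ X ∈ t, ∀ h : realForm e X ∈ 𝔥, ∀ α : 𝔥.root, (α.1 ⟨realForm e X, h⟩).re = 0) :
    ∃ X ∈ Submodule.span ℝ t, ∃ P : ℝ[X], (∀ x, ¬ P.IsRoot x) ∧
      ∀ Y, realForm e (aeval (LieAlgebra.ad ℝ 𝔲 X) P Y) ∈ 𝔥 := by
  have hmem : ∀ X ∈ Submodule.span ℝ t, realForm e X ∈ 𝔥 := by
    intro X hX
    have h1 : Submodule.span ℝ t ≤ (𝔥.toSubmodule.restrictScalars ℝ).comap (realForm e) :=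
      Submodule.span_le.2 fun Y hY => by
        change realForm e Y ∈ 𝔥.toSubmodule
        rw [hT]; exact Submodule.subset_span ⟨Y, hY, rfl⟩
    exact h1 hX
  -- Extending the roots to linear forms on `𝔤` allows evaluation without membership proofs.
  choose β hβ using fun α : 𝔥.root =>
    LinearMap.exists_extend (p := 𝔥.toSubmodule) (LieModule.Weight.toLinear ℂ 𝔥 𝔤 α.1)
  have hβ' : ∀ α : 𝔥.root, ∀ (z : 𝔤) (hz : z ∈ 𝔥), β α z = α.1 ⟨z, hz⟩ := fun α z hz =>
    DFunLike.congr_fun (hβ α) ⟨z, hz⟩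
  have hre : ∀ α : 𝔥.root, ∀ X ∈ Submodule.span ℝ t, (β α (realForm e X)).re = 0 := by
    intro α X hX
    have h1 : Submodule.span ℝ t ≤ LinearMap.ker
        (Complex.reLm ∘ₗ ((β α).restrictScalars ℝ) ∘ₗ realForm e) :=
      Submodule.span_le.2 fun Y hY => by
        have h := hmem Y (Submodule.subset_span hY)
        change (β α (realForm e Y)).re = 0
        rw [hβ' α _ h]
        exact him Y hY h α
    exact h1 hX
  -- Finitely many nonzero real functionals have a common point where none vanishes. Each `Im α` is
  -- nonzero on the real span: otherwise `α`, imaginary there, would vanish on the complex span `𝔥`.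
  obtain ⟨X, hX, hne⟩ := Module.Dual.exists_forall_mem_ne_zero_of_forall_exists
    (Submodule.span ℝ t)
    (fun α : 𝔥.root => Complex.imLm ∘ₗ ((β α).restrictScalars ℝ) ∘ₗ realForm e) (fun α => by
      by_contra! hall
      refine LieSubalgebra.isNonZero_coe_root α ?_
      have h0 : 𝔥.toSubmodule ≤ LinearMap.ker (β α) := by
        rw [hT, Submodule.span_le]
        rintro _ ⟨Y, hY, rfl⟩
        have hY' := Submodule.subset_span (R := ℝ) hY
        exact Complex.ext (hre α Y hY') (hall Y hY')
      ext z
      have := h0 z.2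
      rw [LinearMap.mem_ker, hβ' α _ z.2] at this
      exact this)
  -- Each factor vanishes at `α(X) = i Im α(X)` and is positive on the real line.
  refine ⟨X, hX, ∏ α : 𝔥.root, (Polynomial.X ^ 2 + C ((β α (realForm e X)).im ^ 2)), ?_, ?_⟩
  · intro x hx
    rw [IsRoot.def, eval_prod, Finset.prod_eq_zero_iff] at hx
    obtain ⟨α, -, hα⟩ := hx
    have h1 : (β α (realForm e X)).im ≠ 0 := hne α
    simp only [eval_add, eval_pow, eval_X, eval_C] at hα
    nlinarith [sq_nonneg x, sq_pos_of_ne_zero h1]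
  · intro Y
    rw [map_aeval_of_intertwine (B := LieAlgebra.ad ℂ 𝔤 (realForm e X)) (realForm e)
      (fun v => by rw [LieAlgebra.ad_apply, LieAlgebra.ad_apply, realForm_lie])]
    refine aeval_ad_mem_cartan (hmem X hX) (fun α => ?_) _
    rw [Polynomial.map_prod, eval_prod]
    refine Finset.prod_eq_zero (Finset.mem_univ α) ?_
    rw [← hβ' α _ (hmem X hX)]
    have h1 : β α (realForm e X) = (β α (realForm e X)).im * Complex.I := by
      apply Complex.ext <;> simp [hre α X hX]
    simp only [Polynomial.map_add, Polynomial.map_pow, map_X, map_C, eval_add, eval_pow, eval_X,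
      eval_C]
    conv_lhs => rw [h1]
    simp [mul_pow]

/-- The complexification of `p` is still surjective and kills `𝔥`, so its rank is bounded by the
number of roots. -/
theorem finrank_le_card_root {F : Type*} [AddCommGroup F] [Module ℝ F]
    (e : (ℂ ⊗[ℝ] 𝔲) ≃ₗ⁅ℂ⁆ 𝔤) {t : Set 𝔲}
    (hT : 𝔥.toSubmodule = Submodule.span ℂ (realForm e '' t)) {p : 𝔲 →ₗ[ℝ] F}
    (hp : ∀ X ∈ t, p X = 0) (hsurj : Function.Surjective p) :
    Module.finrank ℝ F ≤ Nat.card 𝔥.root := by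
  have h1 := finrank_range_le_card_root (complexify e p) (complexify_eq_zero e hT hp)
  have h2 : LinearMap.range (complexify e p) = ⊤ := by
    rw [LinearMap.range_eq_top]
    exact (LinearMap.lTensor_surjective ℂ hsurj).comp e.symm.surjective
  rwa [h2, finrank_top, Module.finrank_baseChange] at h1

end RealForm

/-! ### Invariant Dirac structures at the base point -/

section Homogeneous

theorem smul_base {U : Type*} [Group U] {T : Subgroup U} {t : U} (ht : t ∈ T) : t • ((1 : U) : U ⧸ T) = ((1 : U) : U ⧸ T) := by
  rw [MulAction.Quotient.smul_coe, smul_eq_mul, mul_one]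
  exact QuotientGroup.eq.2 (by simpa using ht)

variable {E F : Type*} [NormedAddCommGroup E] [NormedSpace ℝ E] [NormedAddCommGroup F]
  [NormedSpace ℝ F]
  {U : Type*} [TopologicalSpace U] [ChartedSpace E U] [Group U] [LieGroup 𝓘(ℝ, E) ∞ U]
  {T : Subgroup U} [ChartedSpace F (U ⧸ T)]

theorem isotropy_mul (hπ : Manifold.IsSubmersion 𝓘(ℝ, E) 𝓘(ℝ, F) ∞
      (QuotientGroup.mk : U → U ⧸ T)) (s : U) {t : U} (ht : t ∈ T) :
    isotropy F T (s * t) = (isotropy F T s).comp (isotropy F T t) := by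
  have h1 := mfderiv_smul_comp hπ s t ((1 : U) : U ⧸ T)
  rw [smul_base ht] at h1
  exact h1

theorem isotropy_inverse (hπ : Manifold.IsSubmersion 𝓘(ℝ, E) 𝓘(ℝ, F) ∞
      (QuotientGroup.mk : U → U ⧸ T)) {t : U} (ht : t ∈ T) :
    (isotropy F T t).inverse = isotropy F T t⁻¹ := by
  have h0 : isotropy F T (1 : U) = ContinuousLinearMap.id ℝ F := mfderiv_one_smul _
  exact ContinuousLinearMap.inverse_eq
    (by rw [← isotropy_mul hπ t (T.inv_mem ht), mul_inv_cancel, h0])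
    (by rw [← isotropy_mul hπ t⁻¹ ht, inv_mul_cancel, h0])

variable [IsManifold 𝓘(ℝ, F) ∞ (U ⧸ T)]

/-- The fibres of a complex Dirac structure, all read in the model space. -/
def modelFiber (L : ComplexDirac F (U ⧸ T)) (x : U ⧸ T) : Submodule ℂ (CGen F) := L.fiber x

/-- The derivatives of the actions of `g` and `g⁻¹` are mutually inverse. The inequality is enough,
since it can also be applied to `g⁻¹`. -/
theorem realIndex_le_smul [FiniteDimensional ℝ F]
    (hπ : Manifold.IsSubmersion 𝓘(ℝ, E) 𝓘(ℝ, F) ∞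
      (QuotientGroup.mk : U → U ⧸ T))
    {L : ComplexDirac F (U ⧸ T)} (hL : L.IsInvariant U) (g : U) (x : U ⧸ T) :
    Module.finrank ℝ (realPart (modelFiber L x)) ≤
      Module.finrank ℝ (realPart (modelFiber L (g • x))) := by
  have h1 := mfderiv_smul_comp hπ g⁻¹ g x
  have h2 := mfderiv_smul_comp hπ g g⁻¹ (g • x)
  rw [inv_mul_cancel, mfderiv_one_smul] at h1
  rw [mul_inv_cancel, mfderiv_one_smul, inv_smul_smul] at h2
  exact finrank_realPart_le_of_map (V := F) h2.symm h1.symm (hL g x)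

theorem realIndex_eq_base [FiniteDimensional ℝ F]
    (hπ : Manifold.IsSubmersion 𝓘(ℝ, E) 𝓘(ℝ, F) ∞
      (QuotientGroup.mk : U → U ⧸ T))
    {L : ComplexDirac F (U ⧸ T)} (hL : L.IsInvariant U) (x : U ⧸ T) :
    realIndex (L.fiber x) =
      Module.finrank ℝ (realPart (modelFiber L ((1 : U) : U ⧸ T))) := by
  obtain ⟨u, rfl⟩ := QuotientGroup.mk_surjective x
  have h := realIndex_eq_finrank_realPart (modelFiber L (u : U ⧸ T))
  refine h.trans (le_antisymm ?_ ?_)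
  · have h1 := realIndex_le_smul hπ hL u⁻¹ (u : U ⧸ T)
    have h2 : u⁻¹ • (u : U ⧸ T) = ((1 : U) : U ⧸ T) := by
      rw [MulAction.Quotient.smul_coe, smul_eq_mul, inv_mul_cancel]
    rwa [h2] at h1
  · have h1 := realIndex_le_smul hπ hL u ((1 : U) : U ⧸ T)
    have h2 : u • ((1 : U) : U ⧸ T) = (u : U ⧸ T) := by
      rw [MulAction.Quotient.smul_coe, smul_eq_mul, mul_one]
    rwa [h2] at h1

theorem pushGen_isotropy_mem {L : ComplexDirac F (U ⧸ T)} (hL : L.IsInvariant U) {t : U}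
    (ht : t ∈ T) {a : Gen F} (ha : a ∈ realPart (modelFiber L ((1 : U) : U ⧸ T))) :
    pushGen (isotropy F T t) a ∈ realPart (modelFiber L ((1 : U) : U ⧸ T)) := by
  have h : (modelFiber L ((1 : U) : U ⧸ T)).map (pushGenC (isotropy F T t)) =
      modelFiber L (t • ((1 : U) : U ⧸ T)) := hL t _
  rw [smul_base ht] at h
  exact pushGen_mem_realPart h ha

/-- The velocity at `0` of a curve in a finite-dimensional subspace lies in the subspace. -/
theorem hasDerivAt_mem_of_mem {W : Type*} [NormedAddCommGroup W] [NormedSpace ℝ W]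
    [FiniteDimensional ℝ W] (K : Submodule ℝ W) {c : ℝ → W} {c' : W} {s : ℝ}
    (hc : HasDerivAt c c' s) (hK : ∀ s, c s ∈ K) : c' ∈ K :=
  K.closed_of_finiteDimensional.mem_of_tendsto hc.tendsto_slope
    (Filter.Eventually.of_forall fun t => by
      rw [slope_def_module]
      exact K.smul_mem _ (K.sub_mem (hK t) (hK s)))

/-- The elements of the isotropy algebra act on the tangent space at the base point compatibly with
the adjoint representation, and preserve the real points of an invariant Dirac structure. -/
theorem isotropyAlgebra_action [FiniteDimensional ℝ F]
    (hπ : Manifold.IsSubmersion 𝓘(ℝ, E) 𝓘(ℝ, F) ∞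
      (QuotientGroup.mk : U → U ⧸ T)) {S : F →L[ℝ] E}
    (hS : (dproj E F T).comp S = ContinuousLinearMap.id ℝ F)
    {L : ComplexDirac F (U ⧸ T)} (hL : L.IsInvariant U) {X : GroupLieAlgebra 𝓘(ℝ, E) U}
    (hX : X ∈ subgroupLieAlgebra E T) {D : F →L[ℝ] F}
    (hD : D = ((dproj E F T).comp (adL E U (X : E))).comp S) :
    D.comp (dproj E F T) = (dproj E F T).comp (adL E U (X : E)) ∧
      ∀ a ∈ realPart (modelFiber L ((1 : U) : U ⧸ T)),
        ((D a.1, -(a.2.comp D)) : Gen F) ∈ realPart (modelFiber L ((1 : U) : U ⧸ T)) := by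
  obtain ⟨γ, h0, hadd, hT, hd⟩ := exists_oneParameter hX
  have hAd := hasDerivAt_Ad_comp (E := E) h0 hd
  have hinv : ∀ s, (γ s)⁻¹ = γ (-s) := fun s => by
    rw [inv_eq_iff_mul_eq_one, ← hadd, add_neg_cancel, h0]
  -- The right inverse `S` expresses the isotropy action through `Ad`, whose derivative along `γ` is
  -- known.
  have hA : ∀ s, isotropy F T (γ s) = ((dproj E F T).comp (Ad E (γ s))).comp S := fun s => by
    rw [← isotropy_comp_dproj hπ (hT s), ContinuousLinearMap.comp_assoc, hS,
      ContinuousLinearMap.comp_id]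
  have hder : HasDerivAt (fun s => isotropy F T (γ s)) D 0 := by
    rw [hD]
    simp only [hA]
    have h1 := ((hasDerivAt_const (0 : ℝ) (dproj E F T)).clm_comp hAd).clm_comp
      (hasDerivAt_const (0 : ℝ) S)
    exact h1.congr_deriv (by simp)
  constructor
  · have h1 := hder.clm_comp (hasDerivAt_const (0 : ℝ) (dproj E F T))
    have h2 := (hasDerivAt_const (0 : ℝ) (dproj E F T)).clm_comp hAd
    simp only [isotropy_comp_dproj hπ (hT _)] at h1
    simpa using h1.unique h2
  · rintro ⟨v, ξ⟩ ha
    have hfd : FiniteDimensional ℝ (F →L[ℝ] ℝ) :=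
      LinearMap.toContinuousLinearMap.finiteDimensional
    have h1 : HasDerivAt (fun s => isotropy F T (γ s) v) (D v) 0 :=
      (hder.clm_apply (hasDerivAt_const 0 v)).congr_deriv (by simp)
    have h2 : HasDerivAt (fun s => isotropy F T (γ (-s))) (-D) 0 := by
      have h3 : HasDerivAt (fun s => isotropy F T (γ s)) D (-(0 : ℝ)) := by rwa [neg_zero]
      simpa [Function.comp_def] using h3.scomp (0 : ℝ) (hasDerivAt_neg (0 : ℝ))
    have h4 : HasDerivAt (fun s => ξ.comp (isotropy F T (γ (-s)))) (-(ξ.comp D)) 0 :=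
      ((hasDerivAt_const (0 : ℝ) ξ).clm_comp h2).congr_deriv (by simp)
    -- The orbit curve `s ↦ (A_s v, ξ ∘ A_{-s})`, with `A_s` the isotropy action of `γ s`, stays
    -- among the real points; its velocity at `0` is `(D v, -ξ ∘ D)`.
    refine hasDerivAt_mem_of_mem _ (h1.prodMk h4) fun s => ?_
    have h5 := pushGen_isotropy_mem hL (hT s) ha
    have h6 : pushGen (isotropy F T (γ s)) (v, ξ) =
        (isotropy F T (γ s) v, ξ.comp (isotropy F T (γ s)).inverse) := rfl
    rwa [h6, isotropy_inverse hπ (hT s), hinv] at h5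

end Homogeneous

/-! ### Roots are imaginary on the compact real form -/

section Compact

variable {E : Type*} [NormedAddCommGroup E] [NormedSpace ℝ E] [CompleteSpace E]
  {U : Type*} [TopologicalSpace U] [ChartedSpace E U] [Group U] [LieGroup 𝓘(ℝ, E) ∞ U]
  [CompactSpace U]
  {𝔤 : Type*} [LieRing 𝔤] [LieAlgebra ℂ 𝔤] [FiniteDimensional ℂ 𝔤] [LieAlgebra.IsSemisimple ℂ 𝔤]
  {𝔥 : LieSubalgebra ℂ 𝔤} [𝔥.IsCartanSubalgebra]

/-- The roots take imaginary values on the Lie algebra of a subgroup of a compact real form. -/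
theorem re_root_eq_zero (e : (ℂ ⊗[ℝ] GroupLieAlgebra 𝓘(ℝ, E) U) ≃ₗ⁅ℂ⁆ 𝔤) {T : Subgroup U}
    {X : GroupLieAlgebra 𝓘(ℝ, E) U} (hX : X ∈ subgroupLieAlgebra E T) (h : realForm e X ∈ 𝔥)
    (α : 𝔥.root) : (α.1 ⟨realForm e X, h⟩).re = 0 := by
  obtain ⟨γ, h0, hadd, -, hd⟩ := exists_oneParameter hX
  obtain ⟨C, hC⟩ := exists_norm_Ad_le (E := E) (U := U)
  obtain ⟨z, hz, hz0⟩ := α.1.exists_ne_zero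
  have hz1 : ⁅realForm e X, z⁆ = α.1 ⟨realForm e X, h⟩ • z :=
    LieAlgebra.IsKilling.lie_eq_smul_of_mem_rootSpace hz ⟨realForm e X, h⟩
  obtain ⟨a, b, ha, hb, hab⟩ := exists_re_im_of_eigenvector e hz1 hz0
  exact re_eq_zero_of_bounded_flow (E := E) (A := fun s => Ad E (γ s)) (B := adL E U (X : E))
    (hasDerivAt_Ad_oneParameter h0 hadd hd) (by simp only [h0, Ad_one]) (fun s => hC _)
    ((adL_apply X a).trans ha) ((adL_apply X b).trans hb) hab

end Compact

/-! ### Parity of the real index -/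

section Main

open Polynomial

variable {E : Type*} [NormedAddCommGroup E] [NormedSpace ℝ E] [CompleteSpace E]
  {F : Type*} [NormedAddCommGroup F] [NormedSpace ℝ F]
  {U : Type*} [TopologicalSpace U] [ChartedSpace E U] [Group U] [LieGroup 𝓘(ℝ, E) ∞ U]
  {T : Subgroup U} [ChartedSpace F (U ⧸ T)] [IsManifold 𝓘(ℝ, F) ∞ (U ⧸ T)]

variable (E F T) in
/-- The derivative of the projection at the identity, as a linear map on the Lie algebra. -/
def dprojLie : GroupLieAlgebra 𝓘(ℝ, E) U →ₗ[ℝ] F := (dproj E F T : E →ₗ[ℝ] F)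

/-- `subgroupLieAlgebra` is a mere set of velocities, while the regular element lies in its real
span; both conditions are linear in `Y` and so extend to the span. -/
theorem stable_of_mem_span {E F : Type*} [NormedAddCommGroup E] [NormedSpace ℝ E]
    [NormedAddCommGroup F] [NormedSpace ℝ F] {t : Set E} (δ : E →ₗ[ℝ] F →L[ℝ] F)
    (ρ : E →ₗ[ℝ] E →L[ℝ] E) (p : E →L[ℝ] F) {K : Submodule ℝ (Gen F)}
    (h : ∀ Y ∈ t, (δ Y).comp p = p.comp (ρ Y) ∧
      ∀ a ∈ K, ((δ Y a.1, -(a.2.comp (δ Y))) : Gen F) ∈ K) :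
    ∀ Y ∈ Submodule.span ℝ t, (δ Y).comp p = p.comp (ρ Y) ∧
      ∀ a ∈ K, ((δ Y a.1, -(a.2.comp (δ Y))) : Gen F) ∈ K := by
  intro Y hY
  induction hY using Submodule.span_induction with
  | mem Y hY => exact h Y hY
  | zero =>
    refine ⟨by simp, fun a _ => ?_⟩
    convert! K.zero_mem using 1
    simp
  | add Y Z _ _ hY hZ =>
    refine ⟨by simp [hY.1, hZ.1], fun a ha => ?_⟩
    convert! K.add_mem (hY.2 a ha) (hZ.2 a ha) using 1
    simp [add_comm]
  | smul r Y _ hY =>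
    refine ⟨by simp [hY.1], fun a ha => ?_⟩
    convert! K.smul_mem r (hY.2 a ha) using 1
    simp

/-- With `p` the projection and `D` induced by `ad X`, intertwining gives `P(D) ∘ p = p ∘ P(ad X) =
0`. Since `p` has a right inverse, `P(D) = 0`. -/
theorem even_finrank_realPart [FiniteDimensional ℝ F]
    (hπ : Manifold.IsSubmersion 𝓘(ℝ, E) 𝓘(ℝ, F) ∞ (QuotientGroup.mk : U → U ⧸ T))
    {L : ComplexDirac F (U ⧸ T)} (hL : L.IsInvariant U) {X : GroupLieAlgebra 𝓘(ℝ, E) U}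
    (hX : X ∈ Submodule.span ℝ (subgroupLieAlgebra E T)) {P : ℝ[X]} (hP : ∀ x, ¬ P.IsRoot x)
    (hPX : ∀ Y, dprojLie E F T (aeval (LieAlgebra.ad ℝ (GroupLieAlgebra 𝓘(ℝ, E) U) X) P Y) = 0) :
    Even (Module.finrank ℝ (realPart (modelFiber L ((1 : U) : U ⧸ T)))) := by
  obtain ⟨S, hS⟩ := exists_dproj_rightInverse hπ
  let δ : E →ₗ[ℝ] F →L[ℝ] F :=
    { toFun := fun X => ((dproj E F T).comp (adL E U X)).comp S
      map_add' := fun X Y => by simp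
      map_smul' := fun r X => by simp }
  obtain ⟨h1, h2⟩ := stable_of_mem_span δ (adL E U : E →ₗ[ℝ] E →L[ℝ] E) (dproj E F T)
    (fun Y hY => isotropyAlgebra_action hπ hS hL hY rfl) X hX
  refine even_finrank_of_stable (δ X) hP ?_ _ h2
  have h3 : ∀ Y, dprojLie E F T (aeval (LieAlgebra.ad ℝ (GroupLieAlgebra 𝓘(ℝ, E) U) X) P Y) =
      aeval (δ X : F →ₗ[ℝ] F) P (dprojLie E F T Y) := fun Y => by
    have h4 := map_aeval_of_intertwine (A := LieAlgebra.ad ℝ (GroupLieAlgebra 𝓘(ℝ, E) U) X)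
      (B := (δ X : F →ₗ[ℝ] F)) (dprojLie E F T)
      (fun Y => (congrArg (dproj E F T) (adL_apply X Y).symm).trans (DFunLike.congr_fun h1 Y).symm)
      P Y
    rwa [Algebra.algebraMap_self, Polynomial.map_id] at h4
  refine LinearMap.ext fun v => ?_
  have h4 := (h3 (S v)).symm.trans (hPX (S v))
  have h5 : dprojLie E F T (S v) = v := DFunLike.congr_fun hS v
  exact (congrArg _ h5).symm.trans h4

end Main

end DiracFlag

end

open DiracFlag in
/-- `𝔤` is a complex semisimple Lie algebra with Cartan subalgebra `𝔥`, `U` is a compact connected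
Lie group whose Lie algebra is a real form of `𝔤` (through `e`), `T` is the closed connected subgroup
of `U` whose Lie algebra complexifies to `𝔥` (a maximal torus), and the maximal flag manifold `U ⧸ T`
carries its standard smooth structure, the one for which the projection is a submersion. -/
theorem mainTheorem1
    {𝔤 : Type*} [LieRing 𝔤] [LieAlgebra ℂ 𝔤] [FiniteDimensional ℂ 𝔤] [LieAlgebra.IsSemisimple ℂ 𝔤]
    (𝔥 : LieSubalgebra ℂ 𝔤) [𝔥.IsCartanSubalgebra]
    (b : (LieAlgebra.IsKilling.rootSystem 𝔥).Base)
    {E : Type*} [NormedAddCommGroup E] [NormedSpace ℝ E] [FiniteDimensional ℝ E]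
    [CompleteSpace E]
    {U : Type*} [TopologicalSpace U] [ChartedSpace E U] [Group U] [LieGroup 𝓘(ℝ, E) ∞ U]
    [T2Space U] [CompactSpace U] [ConnectedSpace U]
    (e : (ℂ ⊗[ℝ] GroupLieAlgebra 𝓘(ℝ, E) U) ≃ₗ⁅ℂ⁆ 𝔤)
    (T : Subgroup U) (hTclosed : IsClosed (T : Set U)) (hTconn : IsConnected (T : Set U))
    (hT : 𝔥.toSubmodule =
      Submodule.span ℂ ((fun X => e ((1 : ℂ) ⊗ₜ[ℝ] X)) '' DiracFlag.subgroupLieAlgebra E T))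
    {F : Type*} [NormedAddCommGroup F] [NormedSpace ℝ F] [FiniteDimensional ℝ F]
    [ChartedSpace F (U ⧸ T)] [IsManifold 𝓘(ℝ, F) ∞ (U ⧸ T)]
    (hπ : Manifold.IsSubmersion 𝓘(ℝ, E) 𝓘(ℝ, F) ∞ (QuotientGroup.mk : U → U ⧸ T))
    (L : DiracFlag.ComplexDirac F (U ⧸ T)) (hL : L.IsInvariant U) :
    ∃ k : ℕ, k ≤ DiracFlag.numPosRoots b ∧
      ∀ x : U ⧸ T, DiracFlag.realIndex (L.fiber x) = 2 * k := by
  have hT' : 𝔥.toSubmodule = Submodule.span ℂ (realForm e '' subgroupLieAlgebra E T) := hT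
  obtain ⟨X, hX, P, hP, hPX⟩ := exists_regular_polynomial e hT'
    fun X hX h α => re_root_eq_zero e hX h α
  have hker : ∀ X ∈ subgroupLieAlgebra E T, dprojLie E F T X = 0 := fun X hX =>
    dproj_eq_zero hπ hX
  obtain ⟨k, hk⟩ := even_finrank_realPart hπ hL hX hP fun Y =>
    eq_zero_of_realForm_mem e hT' hker (hPX Y)
  have hsurj : Function.Surjective (dprojLie E F T) := by
    obtain ⟨S, hS⟩ := exists_dproj_rightInverse (T := T) hπ
    exact fun v => ⟨S v, DFunLike.congr_fun hS v⟩
  have h1 : Module.finrank ℝ (realPart (modelFiber L ((1 : U) : U ⧸ T))) ≤ Module.finrank ℝ F :=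
    finrank_realPart_le (V := F) (L.isMaximalIsotropic ((1 : U) : U ⧸ T)).prop
  have h2 := finrank_le_card_root e hT' hker hsurj
  have h3 := card_root_le b
  -- The chain is `2k = dim K ≤ dim F ≤ #roots ≤ 2l`.
  exact ⟨k, by omega, fun x => by rw [realIndex_eq_base hπ hL x]; omega⟩
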